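/- Let $\Phi$ be a field of characteristic $0$. All algebras are $\Phi$-algebras, not necessarily associative or unital, and $(x,y,z)=(xy)z-x(yz)$. A $(-1,1)$-algebra is an algebra satisfying the identities $(x,y,y)=0$ and $(x,y,z)+(y,z,x)+(z,x,y)=0$. For a superalgebra ($\mathbb{Z}/2$-graded algebra) $A=A_0\oplus A_1$ let $G(A)=A_0\otimes G_0\oplus A_1\otimes G_1$ be its Grassmann envelope, where $G=G_0\oplus G_1$ is the unital associative Grassmann algebra over $\Phi$ on countably many generators; $A$ is a $(-1,1)$-superalgebra if $G(A)$ is a $(-1,1)$-algebra. For a superalgebra $B$, the variety of superalgebras $\mathrm{Var}(B)$ generated by $B$ is the class of all superalgebras $C$ such that $G(C)$ satisfies every polynomial identity of $G(B)$. Let $F_{(-1,1)}[\emptyset;x]$ be the free $(-1,1)$-superalgebra over $\Phi$ on one odd generator $x$ (and no even generators). Corollary 3.5. The variety $\mathrm{Var}\big(F_{(-1,1)}[\emptyset;x]\big)$ cannot be generated by a finite-dimensional superalgebra: there is no superalgebra $B$ with $\dim_\Phi B<\infty$ and $\mathrm{Var}(B)=\mathrm{Var}\big(F_{(-1,1)}[\emptyset;x]\big)$.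 -/

import Mathlib

open scoped TensorProduct

universe u v

noncomputable section

/-- A superalgebra over `Φ`: a (not necessarily associative or unital) `Φ`-algebra with a
`ℤ/2`-grading `A = A₀ ⊕ A₁`, `Aᵢ Aⱼ ⊆ Aᵢ₊ⱼ`. -/
structure Superalgebra (Φ : Type u) [Field Φ] where
  carrier : Type v
  [ring : NonUnitalNonAssocRing carrier]
  [module : Module Φ carrier]
  [isScalarTower : IsScalarTower Φ carrier carrier]
  [smulCommClass : SMulCommClass Φ carrier carrier]
  /-- `part 0` is the even part, `part 1` the odd part. -/
  part : ZMod 2 → Submodule Φ carrier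
  isCompl : IsCompl (part 0) (part 1)
  mul_mem : ∀ {i j : ZMod 2} {a b : carrier}, a ∈ part i → b ∈ part j → a * b ∈ part (i + j)

attribute [instance] Superalgebra.ring Superalgebra.module Superalgebra.isScalarTower
  Superalgebra.smulCommClass

/-- The (unital, associative) Grassmann algebra on countably many generators `e₀, e₁, …`. -/
abbrev Grassmann (Φ : Type u) [Field Φ] : Type u := ExteriorAlgebra Φ (ℕ →₀ Φ)

/-- The even (`i = 0`) and odd (`i = 1`) part of the Grassmann algebra. -/
abbrev Grassmann.part (Φ : Type u) [Field Φ] (i : ZMod 2) : Submodule Φ (Grassmann Φ) :=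
  CliffordAlgebra.evenOdd (0 : QuadraticForm Φ (ℕ →₀ Φ)) i

/-- The Grassmann envelope `G(A) = A₀ ⊗ G₀ + A₁ ⊗ G₁`, a subalgebra of `A ⊗ G`. -/
def Superalgebra.envelope {Φ : Type u} [Field Φ] (A : Superalgebra.{u, v} Φ) :
    NonUnitalSubalgebra Φ (A.carrier ⊗[Φ] Grassmann Φ) :=
  { Submodule.span Φ {t : A.carrier ⊗[Φ] Grassmann Φ |
      ∃ i : ZMod 2, ∃ a ∈ A.part i, ∃ g ∈ Grassmann.part Φ i, t = a ⊗ₜ[Φ] g} with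
    mul_mem' := by
      intro s t hs ht
      change s ∈ Submodule.span Φ _ at hs
      change t ∈ Submodule.span Φ _ at ht
      change s * t ∈ Submodule.span Φ _
      induction hs, ht using Submodule.span_induction₂ with
      | mem_mem s t hs ht =>
        obtain ⟨i, a, ha, g, hg, rfl⟩ := hs
        obtain ⟨j, b, hb, h, hh, rfl⟩ := ht
        refine Submodule.subset_span ⟨i + j, a * b, A.mul_mem ha hb, g * h, ?_, ?_⟩
        · exact SetLike.mul_mem_graded hg hh
        · exact Algebra.TensorProduct.tmul_mul_tmul a b g h
      | zero_left y hy => rw [zero_mul]; exact Submodule.zero_mem _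
      | zero_right x hx => rw [mul_zero]; exact Submodule.zero_mem _
      | add_left x y z _ _ _ h₁ h₂ => rw [add_mul]; exact Submodule.add_mem _ h₁ h₂
      | add_right x y z _ _ _ h₁ h₂ => rw [mul_add]; exact Submodule.add_mem _ h₁ h₂
      | smul_left r x y _ _ h => rw [smul_mul_assoc]; exact Submodule.smul_mem _ _ h
      | smul_right r x y _ _ h => rw [mul_smul_comm]; exact Submodule.smul_mem _ _ h }

/-- The nonassociative polynomial `f` in the variables `x₀, x₁, …` is an identity of the
algebra `A`. -/
def IsIdentity {Φ : Type u} [Field Φ] (f : FreeNonUnitalNonAssocAlgebra Φ ℕ) (A : Type v)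
    [NonUnitalNonAssocRing A] [Module Φ A] [IsScalarTower Φ A A] [SMulCommClass Φ A A] : Prop :=
  ∀ s : ℕ → A, FreeNonUnitalNonAssocAlgebra.lift Φ s f = 0

/-- `Var(B)`, the variety of superalgebras generated by the superalgebra `B`: all superalgebras `C`
whose Grassmann envelope lies in the variety of algebras generated by `G(B)`, that is, satisfies
all identities of `G(B)`. -/
def Superalgebra.variety {Φ : Type u} [Field Φ] (B : Superalgebra.{u, v} Φ) :
    Set (Superalgebra.{u, v} Φ) :=
  {C | ∀ f : FreeNonUnitalNonAssocAlgebra Φ ℕ, IsIdentity f B.envelope → IsIdentity f C.envelope}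

/-- `(-1,1)`-algebras. -/
def IsMinusOneOne (A : Type v) [NonUnitalNonAssocRing A] : Prop :=
  (∀ x y : A, associator x y y = 0) ∧
    ∀ x y z : A, associator x y z + associator y z x + associator z x y = 0

/-- `(-1,1)`-superalgebras: the Grassmann envelope is a `(-1,1)`-algebra. -/
def Superalgebra.IsMinusOneOne {Φ : Type u} [Field Φ] (B : Superalgebra.{u, v} Φ) : Prop :=
  _root_.IsMinusOneOne B.envelope

/-! ### The free `(-1,1)`-superalgebra on one odd generator

It is the free nonassociative algebra on one generator `x`, graded by the parity of the degree,
modulo the ideal of all elements `f(x)` such that `f(b) = 0` for every odd element `b` of every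
`(-1,1)`-superalgebra. -/

namespace FreeMinusOneOne

variable {Φ : Type u} [Field Φ]

/-- The value `f(b)` of a nonassociative polynomial `f` in one variable. -/
def eval {A : Type v} [NonUnitalNonAssocRing A] [Module Φ A] [IsScalarTower Φ A A]
    [SMulCommClass Φ A A] (b : A) : FreeNonUnitalNonAssocAlgebra Φ Unit →ₙₐ[Φ] A :=
  FreeNonUnitalNonAssocAlgebra.lift Φ fun _ => b

variable (Φ) in
/-- Congruence modulo the ideal of elements vanishing at all odd elements of all
`(-1,1)`-superalgebras. -/
def con : RingCon (FreeNonUnitalNonAssocAlgebra Φ Unit) where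
  r f g := ∀ B : Superalgebra.{u, u} Φ, B.IsMinusOneOne → ∀ b ∈ B.part 1, eval b f = eval b g
  iseqv :=
    { refl := fun _ _ _ _ _ => rfl
      symm := fun h B hB b hb => (h B hB b hb).symm
      trans := fun h k B hB b hb => (h B hB b hb).trans (k B hB b hb) }
  add' h k B hB b hb := by rw [map_add, map_add, h B hB b hb, k B hB b hb]
  mul' h k B hB b hb := by rw [map_mul, map_mul, h B hB b hb, k B hB b hb]

variable (Φ) in
/-- The underlying algebra. -/
abbrev Carrier : Type u := (con Φ).Quotient

instance : SMul Φ (Carrier Φ) :=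
  ⟨(con Φ).smulAux fun c f g h B hB b hb => by rw [map_smul, map_smul, h B hB b hb]⟩

theorem coe_smul (c : Φ) (f : FreeNonUnitalNonAssocAlgebra Φ Unit) :
    ((c • f : FreeNonUnitalNonAssocAlgebra Φ Unit) : Carrier Φ) = c • (f : Carrier Φ) := rfl

instance : Module Φ (Carrier Φ) where
  one_smul := Quotient.ind' fun f => congr_arg RingCon.toQuotient (one_smul Φ f)
  mul_smul c d := Quotient.ind' fun f => congr_arg RingCon.toQuotient (mul_smul c d f)
  smul_zero c := congr_arg RingCon.toQuotient (smul_zero c)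
  smul_add c := Quotient.ind₂' fun f g => congr_arg RingCon.toQuotient (smul_add c f g)
  add_smul c d := Quotient.ind' fun f => congr_arg RingCon.toQuotient (add_smul c d f)
  zero_smul := Quotient.ind' fun f => congr_arg RingCon.toQuotient (zero_smul Φ f)

instance : IsScalarTower Φ (Carrier Φ) (Carrier Φ) where
  smul_assoc c := Quotient.ind₂' fun f g => congr_arg RingCon.toQuotient (smul_mul_assoc c f g)

instance : SMulCommClass Φ (Carrier Φ) (Carrier Φ) where
  smul_comm c := Quotient.ind₂' fun f g =>
    congr_arg RingCon.toQuotient (mul_smul_comm c f g).symm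

variable (Φ) in
/-- The quotient map. -/
def mk : FreeNonUnitalNonAssocAlgebra Φ Unit →ₙₐ[Φ] Carrier Φ where
  toFun f := f
  map_smul' _ _ := rfl
  map_zero' := rfl
  map_add' _ _ := rfl
  map_mul' _ _ := rfl

theorem mk_surjective : Function.Surjective (mk Φ) := Quotient.mk''_surjective

theorem mk_eq_zero {f : FreeNonUnitalNonAssocAlgebra Φ Unit} :
    mk Φ f = 0 ↔ ∀ B : Superalgebra.{u, u} Φ, B.IsMinusOneOne → ∀ b ∈ B.part 1, eval b f = 0 := by
  have : mk Φ f = 0 ↔ con Φ f 0 := (con Φ).eq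
  rw [this]
  change (∀ B : Superalgebra.{u, u} Φ, B.IsMinusOneOne → ∀ b ∈ B.part 1,
    eval b f = eval b 0) ↔ _
  simp only [map_zero]

variable (Φ) in
/-- The span of the monomials whose degree has parity `i`. -/
def freePart (i : ZMod 2) : Submodule Φ (FreeNonUnitalNonAssocAlgebra Φ Unit) :=
  Submodule.span Φ ((fun m : FreeMagma Unit => MonoidAlgebra.single m (1 : Φ)) ''
    {m | (m.length : ZMod 2) = i})

theorem eval_single_mem (B : Superalgebra.{u, v} Φ) {b : B.carrier} (hb : b ∈ B.part 1)
    (m : FreeMagma Unit) :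
    eval b (MonoidAlgebra.single m (1 : Φ)) ∈ B.part (m.length : ZMod 2) := by
  induction m using FreeMagma.recOnMul with
  | ih1 x =>
    have h : eval b (MonoidAlgebra.single (FreeMagma.of x) (1 : Φ)) = b :=
      FreeNonUnitalNonAssocAlgebra.lift_of_apply Φ (fun _ : Unit => b) x
    rw [h]
    simpa using hb
  | ih2 x y hx hy =>
    have h : (MonoidAlgebra.single (x * y) (1 : Φ)) =
        MonoidAlgebra.single x (1 : Φ) * MonoidAlgebra.single y (1 : Φ) := by
      rw [MonoidAlgebra.single_mul_single, one_mul]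
    rw [h, map_mul]
    have := B.mul_mem hx hy
    simpa using this

theorem eval_mem (B : Superalgebra.{u, v} Φ) {b : B.carrier} (hb : b ∈ B.part 1) {i : ZMod 2}
    {f : FreeNonUnitalNonAssocAlgebra Φ Unit} (hf : f ∈ freePart Φ i) : eval b f ∈ B.part i := by
  induction hf using Submodule.span_induction with
  | mem f hf =>
    obtain ⟨m, hm, rfl⟩ := hf
    have hm' : (m.length : ZMod 2) = i := hm
    rw [← hm']
    exact eval_single_mem B hb m
  | zero => rw [map_zero]; exact Submodule.zero_mem _
  | add f g _ _ hf hg => rw [map_add]; exact Submodule.add_mem _ hf hg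
  | smul c f _ hf => rw [map_smul]; exact Submodule.smul_mem _ _ hf

theorem freePart_mul {i j : ZMod 2} {f g : FreeNonUnitalNonAssocAlgebra Φ Unit}
    (hf : f ∈ freePart Φ i) (hg : g ∈ freePart Φ j) : f * g ∈ freePart Φ (i + j) := by
  induction hf, hg using Submodule.span_induction₂ with
  | mem_mem s t hs ht =>
    obtain ⟨m, hm, rfl⟩ := hs
    obtain ⟨n, hn, rfl⟩ := ht
    refine Submodule.subset_span ⟨m * n, ?_, ?_⟩
    · change ((m * n).length : ZMod 2) = i + j
      rw [← show (m.length : ZMod 2) = i from hm, ← show (n.length : ZMod 2) = j from hn]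
      simp
    · simp only [MonoidAlgebra.single_mul_single, one_mul]
  | zero_left y hy => rw [zero_mul]; exact Submodule.zero_mem _
  | zero_right x hx => rw [mul_zero]; exact Submodule.zero_mem _
  | add_left x y z _ _ _ h₁ h₂ => rw [add_mul]; exact Submodule.add_mem _ h₁ h₂
  | add_right x y z _ _ _ h₁ h₂ => rw [mul_add]; exact Submodule.add_mem _ h₁ h₂
  | smul_left r x y _ _ h => rw [smul_mul_assoc]; exact Submodule.smul_mem _ _ h
  | smul_right r x y _ _ h => rw [mul_smul_comm]; exact Submodule.smul_mem _ _ h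

theorem freePart_sup : freePart Φ 0 ⊔ freePart Φ 1 = ⊤ := by
  rw [eq_top_iff]
  rintro f -
  induction f using MonoidAlgebra.induction_linear with
  | zero => exact Submodule.zero_mem _
  | add f g hf hg => exact Submodule.add_mem _ hf hg
  | single m c =>
    have h : MonoidAlgebra.single m c = c • MonoidAlgebra.single m (1 : Φ) := by simp
    rw [h]
    refine Submodule.smul_mem _ _ ?_
    have key : ∀ i : ZMod 2, i = 0 ∨ i = 1 := by decide
    rcases key (m.length : ZMod 2) with hm | hm
    · exact Submodule.mem_sup_left (Submodule.subset_span ⟨m, hm, rfl⟩)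
    · exact Submodule.mem_sup_right (Submodule.subset_span ⟨m, hm, rfl⟩)

variable (Φ) in
/-- The image of the parity grading in the quotient. -/
def part (i : ZMod 2) : Submodule Φ (Carrier Φ) :=
  (freePart Φ i).map (mk Φ : FreeNonUnitalNonAssocAlgebra Φ Unit →ₗ[Φ] Carrier Φ)

theorem part_isCompl : IsCompl (part Φ 0) (part Φ 1) := by
  constructor
  · rw [Submodule.disjoint_def]
    rintro _ ⟨f, hf, rfl⟩ ⟨g, hg, hgf⟩
    refine mk_eq_zero.2 fun B hB b hb => ?_
    have h : mk Φ (g - f) = 0 := by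
      rw [map_sub]
      exact sub_eq_zero.2 hgf
    have h' := mk_eq_zero.1 h B hB b hb
    rw [map_sub, sub_eq_zero] at h'
    refine (Submodule.disjoint_def.1 B.isCompl.disjoint) _ (eval_mem B hb hf) ?_
    rw [← h']
    exact eval_mem B hb hg
  · rw [codisjoint_iff, part, part, ← Submodule.map_sup, freePart_sup, Submodule.map_top,
      LinearMap.range_eq_top]
    exact mk_surjective

end FreeMinusOneOne

/-- `F_{(-1,1)}[∅; x]`, the free `(-1,1)`-superalgebra over `Φ` on one odd generator `x`. -/
def freeMinusOneOne (Φ : Type u) [Field Φ] : Superalgebra.{u, u} Φ where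
  carrier := FreeMinusOneOne.Carrier Φ
  part := FreeMinusOneOne.part Φ
  isCompl := FreeMinusOneOne.part_isCompl
  mul_mem := by
    rintro i j _ _ ⟨f, hf, rfl⟩ ⟨g, hg, rfl⟩
    exact ⟨f * g, FreeMinusOneOne.freePart_mul hf hg, map_mul (FreeMinusOneOne.mk Φ) f g⟩

namespace FreeMinusOneOne

variable {Φ : Type u} [Field Φ]

variable (Φ) in
/-- The free generator `x`. -/
def gen : (freeMinusOneOne Φ).carrier := mk Φ (FreeNonUnitalNonAssocAlgebra.of Φ ())

theorem gen_mem : gen Φ ∈ (freeMinusOneOne Φ).part 1 :=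
  ⟨FreeNonUnitalNonAssocAlgebra.of Φ (),
    Submodule.subset_span ⟨FreeMagma.of (), by simp, rfl⟩, rfl⟩

/-- The homomorphism from the free superalgebra that sends the generator to `b`. -/
def lift (B : Superalgebra.{u, u} Φ) (hB : B.IsMinusOneOne) (b : B.carrier) (hb : b ∈ B.part 1) :
    (freeMinusOneOne Φ).carrier →ₙₐ[Φ] B.carrier where
  toFun := Quotient.lift (fun f => eval b f) fun _ _ h => h B hB b hb
  map_smul' c := Quotient.ind fun f => map_smul (eval b) c f
  map_zero' := map_zero (eval b)
  map_add' := Quotient.ind₂ fun f g => map_add (eval b) f g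
  map_mul' := Quotient.ind₂ fun f g => map_mul (eval b) f g

theorem lift_mk (B : Superalgebra.{u, u} Φ) (hB : B.IsMinusOneOne) (b : B.carrier)
    (hb : b ∈ B.part 1) (f : FreeNonUnitalNonAssocAlgebra Φ Unit) :
    lift B hB b hb (mk Φ f) = eval b f := rfl

/-- The universal property of the free superalgebra. -/
theorem existsUnique_lift (B : Superalgebra.{u, u} Φ) (hB : B.IsMinusOneOne) (b : B.carrier)
    (hb : b ∈ B.part 1) :
    ∃! φ : (freeMinusOneOne Φ).carrier →ₙₐ[Φ] B.carrier,
      φ (gen Φ) = b ∧ ∀ i, ∀ a ∈ (freeMinusOneOne Φ).part i, φ a ∈ B.part i := by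
  refine ⟨lift B hB b hb, ⟨?_, ?_⟩, ?_⟩
  · exact FreeNonUnitalNonAssocAlgebra.lift_of_apply Φ (fun _ : Unit => b) ()
  · rintro i _ ⟨f, hf, rfl⟩
    exact eval_mem B hb hf
  · rintro ψ ⟨hψ, -⟩
    have key : ψ.comp (mk Φ) = eval b := by
      apply FreeNonUnitalNonAssocAlgebra.hom_ext
      rintro ⟨⟩
      rw [eval, FreeNonUnitalNonAssocAlgebra.lift_of_apply]
      exact hψ
    ext a
    obtain ⟨f, rfl⟩ := mk_surjective a
    rw [lift_mk, ← key]
    rfl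

/-- A homomorphism of algebras `A → B` extended to `A ⊗ G → B ⊗ G`. -/
def tensorMap {A B : Superalgebra.{u, u} Φ} (φ : A.carrier →ₙₐ[Φ] B.carrier) :
    (A.carrier ⊗[Φ] Grassmann Φ) →ₗ[Φ] (B.carrier ⊗[Φ] Grassmann Φ) :=
  TensorProduct.map (φ : A.carrier →ₗ[Φ] B.carrier) LinearMap.id

theorem tensorMap_mul {A B : Superalgebra.{u, u} Φ} (φ : A.carrier →ₙₐ[Φ] B.carrier)
    (s t : A.carrier ⊗[Φ] Grassmann Φ) :
    tensorMap φ (s * t) = tensorMap φ s * tensorMap φ t := by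
  induction s with
  | zero => simp
  | add s s' h h' => rw [add_mul, map_add, map_add, add_mul, h, h']
  | tmul a g =>
    induction t with
    | zero => simp
    | add t t' h h' => rw [mul_add, map_add, map_add, mul_add, h, h']
    | tmul b h => simp [tensorMap]

theorem tensorMap_associator {A B : Superalgebra.{u, u} Φ} (φ : A.carrier →ₙₐ[Φ] B.carrier)
    (s t r : A.carrier ⊗[Φ] Grassmann Φ) :
    tensorMap φ (associator s t r) =
      associator (tensorMap φ s) (tensorMap φ t) (tensorMap φ r) := by
  simp only [associator, map_sub, tensorMap_mul]

theorem tensorMap_mem {A B : Superalgebra.{u, u} Φ} (φ : A.carrier →ₙₐ[Φ] B.carrier)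
    (hφ : ∀ i, ∀ a ∈ A.part i, φ a ∈ B.part i) {t : A.carrier ⊗[Φ] Grassmann Φ}
    (ht : t ∈ A.envelope) : tensorMap φ t ∈ B.envelope := by
  change t ∈ Submodule.span Φ _ at ht
  change _ ∈ Submodule.span Φ _
  induction ht using Submodule.span_induction with
  | mem t ht =>
    obtain ⟨i, a, ha, g, hg, rfl⟩ := ht
    exact Submodule.subset_span ⟨i, φ a, hφ i a ha, g, hg, rfl⟩
  | zero => rw [map_zero]; exact Submodule.zero_mem _
  | add s t _ _ hs ht => rw [map_add]; exact Submodule.add_mem _ hs ht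
  | smul c t _ ht => rw [map_smul]; exact Submodule.smul_mem _ _ ht

theorem eq_zero_of_tensorMap (t : (freeMinusOneOne Φ).carrier ⊗[Φ] Grassmann Φ)
    (h : ∀ (B : Superalgebra.{u, u} Φ) (hB : B.IsMinusOneOne) (b : B.carrier) (hb : b ∈ B.part 1),
      tensorMap (lift B hB b hb) t = 0) : t = 0 := by
  classical
  let e := Module.Basis.ofVectorSpace Φ (Grassmann Φ)
  apply (TensorProduct.equivFinsuppOfBasisRight e).injective
  rw [map_zero]
  ext k
  obtain ⟨f, hf⟩ := mk_surjective (TensorProduct.equivFinsuppOfBasisRight e t k)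
  rw [Finsupp.zero_apply, ← hf]
  refine mk_eq_zero.2 fun B hB b hb => ?_
  rw [← lift_mk B hB b hb, hf]
  have key : ∀ s : (freeMinusOneOne Φ).carrier ⊗[Φ] Grassmann Φ,
      lift B hB b hb (TensorProduct.equivFinsuppOfBasisRight e s k) =
        TensorProduct.equivFinsuppOfBasisRight e (tensorMap (lift B hB b hb) s) k := by
    intro s
    induction s with
    | zero => simp
    | add s t hs ht => simp only [map_add, Finsupp.add_apply, hs, ht]
    | tmul a g => simp [tensorMap]
  exact (key t).trans (by rw [h B hB b hb, map_zero, Finsupp.zero_apply])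

/-- The free `(-1,1)`-superalgebra is a `(-1,1)`-superalgebra. -/
theorem isMinusOneOne : (freeMinusOneOne Φ).IsMinusOneOne := by
  have hmem : ∀ (B : Superalgebra.{u, u} Φ) (hB : B.IsMinusOneOne) (b : B.carrier)
      (hb : b ∈ B.part 1) (t : (freeMinusOneOne Φ).envelope),
      tensorMap (lift B hB b hb) t.1 ∈ B.envelope := fun B hB b hb t =>
    tensorMap_mem _ (by rintro i _ ⟨f, hf, rfl⟩; exact eval_mem B hb hf) t.2
  constructor
  · intro x y
    apply Subtype.ext
    refine eq_zero_of_tensorMap _ fun B hB b hb => ?_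
    have h := congr_arg Subtype.val (hB.1 ⟨_, hmem B hB b hb x⟩ ⟨_, hmem B hB b hb y⟩)
    exact (tensorMap_associator _ _ _ _).trans h
  · intro x y z
    apply Subtype.ext
    refine eq_zero_of_tensorMap _ fun B hB b hb => ?_
    have h := congr_arg Subtype.val (hB.2 ⟨_, hmem B hB b hb x⟩ ⟨_, hmem B hB b hb y⟩
      ⟨_, hmem B hB b hb z⟩)
    refine Eq.trans ?_ h
    change tensorMap _ (associator x.1 y.1 z.1 + associator y.1 z.1 x.1 + associator z.1 x.1 y.1)
      = _
    rw [map_add, map_add, tensorMap_associator, tensorMap_associator, tensorMap_associator]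
    rfl

end FreeMinusOneOne

end

/-! Some word in one odd element vanishes in every finite-dimensional `(-1,1)`-superalgebra, even
after extension of scalars, but not in the free superalgebra. Write `R_y` for right multiplication
by `y`, put `a = x²` and `C = [R_a, R_x²]`. The words are `x² C^r` (`commutatorWord`).

In every `(-1,1)`-superalgebra without torsion, `C` commutes with `R_a` on even elements
(`commutator_commutator`). If `R_a` is also integral over a commutative ring of scalars, the
Jacobson (Kleinecke–Shirokov) argument makes `C` nilpotent, with index bounded by the degree of the
integral equation (`commutator_pow_eq_zero`).

For finite-dimensional `B`, a second Grassmann factor turns `G(B)` into the superalgebra `G(B) ⊗ G`.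
An odd element of it has coefficients in `G₀ ⊗ G₁` and `G₁ ⊗ G₁`. The latter coefficients commute
and generate a commutative ring `K`. The former anticommute, at most `dim B` of them are needed, and
so they generate an image of a finite exterior algebra. Right multiplications by the element and by
its square therefore preserve a `K`-module whose number of generators depends on `dim B` only
(`exists_stable_submodule`). By Cayley–Hamilton `R_a` is integral there with bounded degree, so one
`r` serves all odd elements (`exists_commutatorWord_eq_zero`).

On the other hand `x² C^r ≠ 0` for every `r` in the free superalgebra: in a model on `Φ[t] ⊕ Φ[t]`,
`C` multiplies even elements of the form in question by `2` (`VectorType.commutatorWord_one`).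
Contracting the extra Grassmann factor turns the vanishing in `G(B) ⊗ G` into ordinary identities of
`G(B)` (`wordPolynomial`). If these held in the envelope of the free superalgebra, substituting `x ⊗
eᵢ` would give `z^(4r+2) ⊗ x² C^r = 0` with `z = ∑ eᵢ ⊗ eᵢ`. With `4r+2` generators the power of `z`
is nonzero (`diagonalSum_pow_ne_zero`), a contradiction. -/

/-- The identities of a `(-1,1)`-superalgebra, for the homogeneous elements with respect to two
additive subgroups `E` (even) and `O` (odd) of a nonassociative ring. -/
structure IsSuperMinusOneOne {T : Type*} [NonUnitalNonAssocRing T] (E O : AddSubgroup T) :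
    Prop where
  ee : ∀ {a b : T}, a ∈ E → b ∈ E → a * b ∈ E
  eo : ∀ {a b : T}, a ∈ E → b ∈ O → a * b ∈ O
  oe : ∀ {a b : T}, a ∈ O → b ∈ E → a * b ∈ O
  oo : ∀ {a b : T}, a ∈ O → b ∈ O → a * b ∈ E
  right_alt_even : ∀ {a b c : T}, (a ∈ E ∨ a ∈ O) → (b ∈ E ∨ b ∈ O) → c ∈ E →
    associator a b c + associator a c b = 0
  right_alt_odd : ∀ {a b c : T}, (a ∈ E ∨ a ∈ O) → b ∈ O → c ∈ O →
    associator a b c - associator a c b = 0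
  cyclic_even : ∀ {a b c : T}, (a ∈ E ∨ a ∈ O) → b ∈ E → c ∈ E →
    associator a b c + associator b c a + associator c a b = 0
  cyclic_two_odd : ∀ {a b c : T}, a ∈ E → b ∈ O → c ∈ O →
    associator a b c + associator b c a - associator c a b = 0
  cyclic_odd : ∀ {a b c : T}, a ∈ O → b ∈ O → c ∈ O →
    associator a b c + associator b c a + associator c a b = 0

/-! ### Identities of degree five, by explicit certificates. -/

namespace IsSuperMinusOneOne

variable {T : Type*} [NonUnitalNonAssocRing T] [IsAddTorsionFree T] {E O : AddSubgroup T}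
  {x y : T}

theorem eq_of_zsmul_sub_eq_zero {n : ℤ} (hn : n ≠ 0) {a b : T} (h : n • (a - b) = 0) : a = b :=
  sub_eq_zero.1 ((smul_eq_zero.1 h).resolve_left hn)

/-- Together with `associator_mul_comm_of_odd` this says that `u = (y, x², x)` supercommutes with
`x`: the sign depends on the parity of `u`, which is opposite to that of `y`. -/
theorem associator_mul_anticomm_of_even (h : IsSuperMinusOneOne E O) (hx : x ∈ O) (hy : y ∈ E) :
    associator y (x * x) x * x = -(x * associator y (x * x) x) := by
  have m1 := h.oo hx hx
  have m2 := h.oe hx hy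
  have m3 := h.oo hx m2
  have m4 := h.eo hy hx
  have m5 := h.oo hx m4
  have m6 := h.eo m1 hx
  have m7 := h.oe hx m1
  have m8 := h.ee hy m1
  -- The certificate writes `18` times the difference as an integer combination of instances of the
  -- defining identities, of total degree five and linear in `y`, some multiplied on one side or
  -- another. Once associators are unfolded, nonassociative monomials cancel additively, so `abel`
  -- suffices. The factor clears denominators and is removed by torsion-freeness; the four lemmas
  -- that follow work the same way.
  refine eq_of_zsmul_sub_eq_zero (n := 18) (by decide) ?_
  linear_combination (norm := (simp only [associator, mul_sub, sub_mul, mul_add, add_mul,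
    smul_sub, smul_add, mul_zero, zero_mul]; abel))
    (6 : ℤ) • h.cyclic_two_odd m1 hx m2 +
    (6 : ℤ) • h.cyclic_even (.inl m1) hy m1 +
    (3 : ℤ) • h.cyclic_two_odd m3 hx hx +
    (6 : ℤ) • h.cyclic_two_odd m5 hx hx +
    (-6 : ℤ) • h.cyclic_two_odd hy hx m6 +
    (12 : ℤ) • congrArg (x * ·) (h.cyclic_even (.inr hx) hy m1) +
    (3 : ℤ) • congrArg (x * ·) (congrArg (x * ·) (h.cyclic_two_odd hy hx hx)) +
    (-9 : ℤ) • congrArg (x * ·) (congrArg (x * ·) (h.right_alt_even (.inr hx) (.inr hx) hy)) +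
    (-3 : ℤ) • congrArg (x * ·) (congrArg (· * y) (h.cyclic_odd hx hx hx)) +
    (-6 : ℤ) • congrArg (x * ·) (h.right_alt_even (.inr hx) (.inl m1) hy) +
    (-12 : ℤ) • congrArg (x * ·) (h.right_alt_odd (.inr hx) m2 hx) +
    (3 : ℤ) • congrArg (x * ·) (h.right_alt_odd (.inr hx) m4 hx) +
    (-3 : ℤ) • congrArg (x * ·) (h.right_alt_even (.inl hy) (.inr hx) m1) +
    (6 : ℤ) • congrArg (y * ·) (h.right_alt_even (.inr hx) (.inr hx) m1) +
    (-6 : ℤ) • congrArg ((x * x) * ·) (h.cyclic_two_odd hy hx hx) +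
    (3 : ℤ) • congrArg ((x * x) * ·) (h.right_alt_even (.inr hx) (.inr hx) hy) +
    (-2 : ℤ) • congrArg ((x * y) * ·) (h.cyclic_odd hx hx hx) +
    (1 : ℤ) • congrArg (· * (x * y)) (h.cyclic_odd hx hx hx) +
    (6 : ℤ) • congrArg (· * (x * x)) (h.cyclic_two_odd hy hx hx) +
    (12 : ℤ) • congrArg (· * x) (h.cyclic_even (.inr hx) hy m1) +
    (-6 : ℤ) • congrArg (· * x) (congrArg (x * ·) (h.cyclic_two_odd hy hx hx)) +
    (-9 : ℤ) • congrArg (· * x) (congrArg (x * ·) (h.right_alt_even (.inr hx) (.inr hx) hy)) +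
    (-6 : ℤ) • congrArg (· * x) (congrArg (· * y) (h.cyclic_odd hx hx hx)) +
    (-3 : ℤ) • congrArg (· * (x * x)) (h.right_alt_even (.inr hx) (.inr hx) hy) +
    (3 : ℤ) • congrArg (· * y) (h.right_alt_even (.inr hx) (.inr hx) m1) +
    (-15 : ℤ) • congrArg (· * x) (h.right_alt_even (.inr hx) (.inl m1) hy) +
    (-3 : ℤ) • congrArg (· * x) (h.right_alt_odd (.inr hx) m2 hx) +
    (-6 : ℤ) • congrArg (· * x) (h.right_alt_odd (.inr hx) m4 hx) +
    (6 : ℤ) • congrArg (· * x) (h.right_alt_even (.inl hy) (.inr hx) m1) +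
    (-3 : ℤ) • h.right_alt_even (.inr hx) (.inr m4) m1 +
    (3 : ℤ) • h.right_alt_even (.inr hx) (.inr m7) hy +
    (-9 : ℤ) • h.right_alt_even (.inr hx) (.inr hx) m3 +
    (9 : ℤ) • h.right_alt_even (.inr hx) (.inr hx) m5 +
    (-9 : ℤ) • h.right_alt_even (.inr hx) (.inr hx) m8 +
    (9 : ℤ) • h.right_alt_even (.inr hx) (.inr m6) hy +
    (6 : ℤ) • h.right_alt_odd (.inl hy) m7 hx +
    (-9 : ℤ) • h.right_alt_even (.inl m1) (.inl m1) hy +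
    (9 : ℤ) • h.right_alt_odd (.inl m1) m2 hx +
    (-6 : ℤ) • h.right_alt_odd (.inl m1) m4 hx +
    (9 : ℤ) • h.right_alt_even (.inr m2) (.inr hx) m1 +
    (-3 : ℤ) • h.right_alt_even (.inr m7) (.inr hx) hy +
    (-6 : ℤ) • h.right_alt_even (.inr m4) (.inr hx) m1

theorem associator_mul_comm_of_odd (h : IsSuperMinusOneOne E O) (hx : x ∈ O) (hy : y ∈ O) :
    associator y (x * x) x * x = x * associator y (x * x) x := by
  have m1 := h.oo hx hy
  have m2 := h.oo hx hx
  have m3 := h.oe hx m1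
  have m4 := h.oo hy hx
  have m5 := h.oe hx m4
  have m6 := h.eo m2 hx
  have m7 := h.oe hx m2
  have m8 := h.oe hy m2
  refine eq_of_zsmul_sub_eq_zero (n := 18) (by decide) ?_
  linear_combination (norm := (simp only [associator, mul_sub, sub_mul, mul_add, add_mul,
    smul_sub, smul_add, mul_zero, zero_mul]; abel))
    (6 : ℤ) • h.cyclic_even (.inr hx) m1 m2 +
    (6 : ℤ) • h.cyclic_even (.inr hy) m2 m2 +
    (3 : ℤ) • h.cyclic_odd m3 hx hx +
    (-6 : ℤ) • h.cyclic_odd m5 hx hx +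
    (-6 : ℤ) • h.cyclic_odd m6 hy hx +
    (12 : ℤ) • congrArg (x * ·) (h.cyclic_two_odd m2 hx hy) +
    (3 : ℤ) • congrArg (x * ·) (congrArg (x * ·) (h.cyclic_odd hx hx hy)) +
    (-9 : ℤ) • congrArg (x * ·) (congrArg (x * ·) (h.right_alt_odd (.inr hx) hx hy)) +
    (-3 : ℤ) • congrArg (x * ·) (congrArg (· * y) (h.cyclic_odd hx hx hx)) +
    (-6 : ℤ) • congrArg (x * ·) (h.right_alt_even (.inr hx) (.inr hy) m2) +
    (12 : ℤ) • congrArg (x * ·) (h.right_alt_even (.inr hx) (.inr hx) m1) +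
    (3 : ℤ) • congrArg (x * ·) (h.right_alt_even (.inr hx) (.inr hx) m4) +
    (3 : ℤ) • congrArg (x * ·) (h.right_alt_even (.inr hy) (.inr hx) m2) +
    (6 : ℤ) • congrArg (y * ·) (h.right_alt_even (.inr hx) (.inr hx) m2) +
    (-6 : ℤ) • congrArg ((x * x) * ·) (h.cyclic_odd hx hx hy) +
    (3 : ℤ) • congrArg ((x * x) * ·) (h.right_alt_odd (.inr hx) hx hy) +
    (2 : ℤ) • congrArg ((x * y) * ·) (h.cyclic_odd hx hx hx) +
    (1 : ℤ) • congrArg (· * (x * y)) (h.cyclic_odd hx hx hx) +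
    (6 : ℤ) • congrArg (· * (x * x)) (h.cyclic_odd hx hx hy) +
    (-12 : ℤ) • congrArg (· * x) (h.cyclic_two_odd m2 hx hy) +
    (6 : ℤ) • congrArg (· * x) (congrArg (x * ·) (h.cyclic_odd hx hx hy)) +
    (9 : ℤ) • congrArg (· * x) (congrArg (x * ·) (h.right_alt_odd (.inr hx) hx hy)) +
    (6 : ℤ) • congrArg (· * x) (congrArg (· * y) (h.cyclic_odd hx hx hx)) +
    (-3 : ℤ) • congrArg (· * (x * x)) (h.right_alt_odd (.inr hx) hx hy) +
    (3 : ℤ) • congrArg (· * y) (h.right_alt_even (.inr hx) (.inr hx) m2) +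
    (15 : ℤ) • congrArg (· * x) (h.right_alt_even (.inr hx) (.inr hy) m2) +
    (-3 : ℤ) • congrArg (· * x) (h.right_alt_even (.inr hx) (.inr hx) m1) +
    (6 : ℤ) • congrArg (· * x) (h.right_alt_even (.inr hx) (.inr hx) m4) +
    (6 : ℤ) • congrArg (· * x) (h.right_alt_even (.inr hy) (.inr hx) m2) +
    (3 : ℤ) • h.right_alt_even (.inr hx) (.inl m2) m4 +
    (3 : ℤ) • h.right_alt_odd (.inr hx) m7 hy +
    (9 : ℤ) • h.right_alt_odd (.inr hx) m3 hx +
    (9 : ℤ) • h.right_alt_odd (.inr hx) m5 hx +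
    (9 : ℤ) • h.right_alt_odd (.inr hx) m8 hx +
    (9 : ℤ) • h.right_alt_odd (.inr hx) m6 hy +
    (6 : ℤ) • h.right_alt_odd (.inr hy) m7 hx +
    (-9 : ℤ) • h.right_alt_even (.inl m2) (.inr hy) m2 +
    (-9 : ℤ) • h.right_alt_even (.inl m2) (.inr hx) m1 +
    (-6 : ℤ) • h.right_alt_even (.inl m2) (.inr hx) m4 +
    (-9 : ℤ) • h.right_alt_even (.inl m1) (.inr hx) m2 +
    (-3 : ℤ) • h.right_alt_odd (.inr m7) hx hy +
    (-6 : ℤ) • h.right_alt_even (.inl m4) (.inr hx) m2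

theorem associator_mul_sq_comm (h : IsSuperMinusOneOne E O) (hx : x ∈ O) (hy : y ∈ E) :
    associator y x x * (x * x) = (x * x) * associator y x x := by
  have m1 := h.oo hx hx
  have m2 := h.eo hy hx
  have m3 := h.oe hx hy
  have m4 := h.oe hx m1
  have m5 := h.oo hx m2
  have m6 := h.ee hy m1
  have m7 := h.eo m1 hx
  have m8 := h.ee m1 hy
  have m9 := h.oo m3 hx
  have m10 := h.oo m2 hx
  refine eq_of_zsmul_sub_eq_zero (n := 9) (by decide) ?_
  linear_combination (norm := (simp only [associator, mul_sub, sub_mul, mul_add, add_mul,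
    smul_sub, smul_add, mul_zero, zero_mul]; abel))
    (-12 : ℤ) • h.cyclic_two_odd m1 hx m2 +
    (-6 : ℤ) • h.cyclic_even (.inl m1) hy m1 +
    (6 : ℤ) • h.cyclic_two_odd m1 m3 hx +
    (-6 : ℤ) • h.cyclic_two_odd hy m4 hx +
    (-12 : ℤ) • h.cyclic_two_odd m5 hx hx +
    (3 : ℤ) • h.cyclic_two_odd m6 hx hx +
    (12 : ℤ) • h.cyclic_two_odd hy hx m7 +
    (-6 : ℤ) • h.cyclic_two_odd m8 hx hx +
    (6 : ℤ) • h.cyclic_two_odd m9 hx hx +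
    (-9 : ℤ) • h.cyclic_two_odd m10 hx hx +
    (9 : ℤ) • congrArg (x * ·) (h.cyclic_odd m2 hx hx) +
    (-3 : ℤ) • congrArg (x * ·) (congrArg (x * ·) (h.cyclic_two_odd hy hx hx)) +
    (-3 : ℤ) • congrArg (x * ·) (congrArg (x * ·) (h.right_alt_even (.inr hx) (.inr hx) hy)) +
    (-1 : ℤ) • congrArg (x * ·) (congrArg (y * ·) (h.cyclic_odd hx hx hx)) +
    (-6 : ℤ) • congrArg (x * ·) (congrArg (· * x) (h.right_alt_even (.inr hx) (.inr hx) hy)) +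
    (-6 : ℤ) • congrArg (x * ·) (h.right_alt_odd (.inr hx) m3 hx) +
    (-3 : ℤ) • congrArg (x * ·) (h.right_alt_odd (.inr hx) m2 hx) +
    (-3 : ℤ) • congrArg (x * ·) (h.right_alt_even (.inl hy) (.inr hx) m1) +
    (12 : ℤ) • congrArg (x * ·) (h.right_alt_even (.inl m1) (.inr hx) hy) +
    (2 : ℤ) • congrArg (y * ·) (congrArg (x * ·) (h.cyclic_odd hx hx hx)) +
    (-6 : ℤ) • congrArg (y * ·) (h.right_alt_even (.inr hx) (.inr hx) m1) +
    (9 : ℤ) • congrArg (· * x) (h.cyclic_odd m2 hx hx) +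
    (-2 : ℤ) • congrArg (· * y) (congrArg (x * ·) (h.cyclic_odd hx hx hx)) +
    (-3 : ℤ) • congrArg (· * x) (congrArg (x * ·) (h.cyclic_two_odd hy hx hx)) +
    (-3 : ℤ) • congrArg (· * x) (congrArg (x * ·) (h.right_alt_even (.inr hx) (.inr hx) hy)) +
    (-1 : ℤ) • congrArg (· * x) (congrArg (y * ·) (h.cyclic_odd hx hx hx)) +
    (-6 : ℤ) • congrArg (· * x) (congrArg (· * x) (h.right_alt_even (.inr hx) (.inr hx) hy)) +
    (6 : ℤ) • congrArg (· * y) (h.right_alt_even (.inr hx) (.inr hx) m1) +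
    (-6 : ℤ) • congrArg (· * x) (h.right_alt_odd (.inr hx) m3 hx) +
    (-3 : ℤ) • congrArg (· * x) (h.right_alt_odd (.inr hx) m2 hx) +
    (-3 : ℤ) • congrArg (· * x) (h.right_alt_even (.inl hy) (.inr hx) m1) +
    (12 : ℤ) • congrArg (· * x) (h.right_alt_even (.inl m1) (.inr hx) hy)

theorem associator_sq_even_sq (h : IsSuperMinusOneOne E O) (hx : x ∈ O) (hy : y ∈ E) :
    associator (x * x) y (x * x) = 0 := by
  have m1 := h.oo hx hx
  have m2 := h.eo hy hx
  have m3 := h.ee hy m1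
  have m4 := h.oe hx hy
  have m5 := h.ee m1 hy
  refine eq_of_zsmul_sub_eq_zero (n := 6) (by decide) ?_
  linear_combination (norm := (simp only [associator, mul_sub, sub_mul, mul_add, add_mul,
    smul_sub, smul_add, mul_zero, zero_mul]; abel))
    (-6 : ℤ) • h.cyclic_two_odd m1 hx m2 +
    (-3 : ℤ) • h.cyclic_two_odd m3 hx hx +
    (2 : ℤ) • congrArg (x * ·) (congrArg (· * y) (h.cyclic_odd hx hx hx)) +
    (6 : ℤ) • congrArg (x * ·) (h.right_alt_even (.inr hx) (.inl m1) hy) +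
    (-6 : ℤ) • congrArg (x * ·) (h.right_alt_even (.inl m1) (.inr hx) hy) +
    (6 : ℤ) • congrArg ((x * x) * ·) (h.right_alt_even (.inr hx) (.inr hx) hy) +
    (1 : ℤ) • congrArg ((y * x) * ·) (h.cyclic_odd hx hx hx) +
    (2 : ℤ) • congrArg (· * (x * y)) (h.cyclic_odd hx hx hx) +
    (2 : ℤ) • congrArg (· * (y * x)) (h.cyclic_odd hx hx hx) +
    (3 : ℤ) • congrArg (· * (x * x)) (h.cyclic_two_odd hy hx hx) +
    (-6 : ℤ) • congrArg (· * x) (h.cyclic_even (.inr hx) m1 hy) +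
    (1 : ℤ) • congrArg (· * x) (congrArg (y * ·) (h.cyclic_odd hx hx hx)) +
    (-2 : ℤ) • congrArg (· * x) (congrArg (· * y) (h.cyclic_odd hx hx hx)) +
    (3 : ℤ) • congrArg (· * (x * x)) (h.right_alt_even (.inr hx) (.inr hx) hy) +
    (3 : ℤ) • congrArg (· * x) (h.right_alt_even (.inl hy) (.inr hx) m1) +
    (6 : ℤ) • congrArg (· * x) (h.right_alt_even (.inl m1) (.inr hx) hy) +
    (6 : ℤ) • h.right_alt_even (.inr hx) (.inr m4) m1 +
    (6 : ℤ) • h.right_alt_even (.inr hx) (.inr m2) m1 +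
    (-3 : ℤ) • h.right_alt_even (.inr hx) (.inr hx) m3 +
    (-6 : ℤ) • h.right_alt_even (.inr hx) (.inr hx) m5 +
    (6 : ℤ) • h.right_alt_odd (.inl m1) m4 hx +
    (-3 : ℤ) • h.right_alt_even (.inr m2) (.inr hx) m1

/-- This case makes words of degree five in `x` alone collapse, see `degree_five`. -/
theorem associator_sq_self_sq (h : IsSuperMinusOneOne E O) (hx : x ∈ O) :
    associator (x * x) x (x * x) = 0 := by
  have m1 := h.oo hx hx
  have m2 := h.oe hx m1
  have m3 := h.eo m1 hx
  refine eq_of_zsmul_sub_eq_zero (n := 2) (by decide) ?_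
  linear_combination (norm := (simp only [associator, mul_sub, sub_mul, mul_add, add_mul,
    smul_sub, smul_add, mul_zero, zero_mul]; abel))
    (-1 : ℤ) • h.cyclic_odd m2 hx hx +
    (1 : ℤ) • congrArg (x * ·) (h.cyclic_two_odd m1 hx hx) +
    (2 : ℤ) • congrArg (x * ·) (h.right_alt_even (.inr hx) (.inr hx) m1) +
    (1 : ℤ) • congrArg (· * (x * x)) (h.cyclic_odd hx hx hx) +
    (1 : ℤ) • congrArg (· * x) (h.right_alt_even (.inr hx) (.inr hx) m1) +
    (1 : ℤ) • h.right_alt_even (.inr hx) (.inl m1) m1 +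
    (2 : ℤ) • h.right_alt_odd (.inr hx) m2 hx +
    (1 : ℤ) • h.right_alt_odd (.inr hx) m3 hx +
    (-1 : ℤ) • h.right_alt_even (.inl m1) (.inr hx) m1

end IsSuperMinusOneOne

/-! ### The operators `R_x`, `R_{x²}` and `D : y ↦ (y, x², x)`. -/

namespace IsSuperMinusOneOne

variable {T : Type*} [NonUnitalNonAssocRing T] [IsAddTorsionFree T] {E O : AddSubgroup T}
  {x y a b : T}

theorem mul_sq_self (h : IsSuperMinusOneOne E O) (hx : x ∈ O) : x * (x * x) = x * x * x := by
  refine eq_of_zsmul_sub_eq_zero (n := -3) (by decide) ?_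
  linear_combination (norm := (simp only [associator, smul_sub]; abel)) h.cyclic_odd hx hx hx

theorem mul_mul_self (h : IsSuperMinusOneOne E O) (hy : y ∈ E ∨ y ∈ O) (ha : a ∈ E) :
    y * (a * a) = y * a * a := by
  refine eq_of_zsmul_sub_eq_zero (n := -2) (by decide) ?_
  linear_combination (norm := (simp only [associator, smul_sub]; abel))
    h.right_alt_even hy (.inl ha) ha

/-- The relations between the elements of degree five generated by an odd element `x`, where
`a = x²` and `b = x³`. -/
theorem degree_five (h : IsSuperMinusOneOne E O) (hx : x ∈ O) (ha : a = x * x) (hb : b = a * x) :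
    b * a = a * b ∧ a * a * x = a * b ∧ x * (a * a) = a * b := by
  have hae : a ∈ E := ha ▸ h.oo hx hx
  have hb' : x * a = b := by rw [hb, ha, h.mul_sq_self hx]
  have h1 := h.associator_sq_self_sq hx
  have h2 := h.right_alt_even (.inl hae) (.inr hx) hae
  have h3 := h.mul_mul_self (.inr hx) hae
  rw [← ha] at h1
  have h4 : associator a a x = 0 := by rwa [h1, zero_add] at h2
  rw [associator, hb', ← hb, sub_eq_zero] at h1
  rw [associator, ← hb, sub_eq_zero] at h4
  exact ⟨h1, h4, by rw [h3, hb', h1]⟩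

/-- For even `y` or odd `y`, `2 y x³ = (y x²) x + (y x) x²`. -/
theorem two_mul_cube (h : IsSuperMinusOneOne E O) (hx : x ∈ O) (ha : a = x * x) (hb : b = a * x)
    (hy : y ∈ E ∨ y ∈ O) : y * b + y * b = y * a * x + y * x * a := by
  have hae : a ∈ E := ha ▸ h.oo hx hx
  have hb' : x * a = b := by rw [hb, ha, h.mul_sq_self hx]
  have h1 := h.right_alt_even hy (.inr hx) hae
  simp only [associator, hb', ← hb] at h1
  linear_combination (norm := abel) -h1

/-- In operator form, `D` commutes with `R_a`. Right alternativity on `(y, x, a²)` and on `(y, x³,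
a)` produces the same term `y (a x³)` by `degree_five`; subtracting eliminates it, and
`two_mul_cube` rewrites the rest. -/
theorem associator_mul_left (h : IsSuperMinusOneOne E O) (hx : x ∈ O) (ha : a = x * x)
    (hy : y ∈ E ∨ y ∈ O) : associator (y * a) a x = associator y a x * a := by
  obtain ⟨b, hb⟩ : ∃ b, b = a * x := ⟨_, rfl⟩
  have hae : a ∈ E := ha ▸ h.oo hx hx
  have hbo : b ∈ O := hb ▸ h.eo hae hx
  have hya : y * a ∈ E ∨ y * a ∈ O := hy.imp (h.ee · hae) (h.oe · hae)
  have hyx : y * x ∈ E ∨ y * x ∈ O := hy.symm.imp (h.oo · hx) (h.eo · hx)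
  obtain ⟨h1, h2, h3⟩ := h.degree_five hx ha hb
  have e1 := h.two_mul_cube hx ha hb hy
  have e2 := h.two_mul_cube hx ha hb hya
  have e3 := h.mul_mul_self hy hae
  have e4 := h.mul_mul_self hyx hae
  have e5 := h.right_alt_even hy (.inr hx) (h.ee hae hae)
  have e6 := h.right_alt_even hy (.inr hbo) hae
  simp only [associator, h1, h2, h3, e3, e4] at e5 e6
  refine eq_of_zsmul_sub_eq_zero (n := 2) (by decide) ?_
  simp only [associator, ← hb]
  have e7 := congrArg (· * a) e1
  simp only [add_mul] at e7
  linear_combination (norm := (simp only [smul_sub, sub_mul]; abel))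
    e7 + e7 + (2 : ℤ) • e5 - (2 : ℤ) • e6

/-- An element `u` that supercommutes with `x` commutes with `x²`: in the cyclic identity on `x, x,
u` everything cancels except `x² u - u x²`. The odd case below is the same with other signs. -/
theorem associator_comm_sq_of_even (h : IsSuperMinusOneOne E O) (hx : x ∈ O) (ha : a = x * x)
    (hy : y ∈ E) : associator y a x * a = a * associator y a x := by
  have h1 := h.associator_mul_anticomm_of_even hx hy
  have hae : a ∈ E := ha ▸ h.oo hx hx
  rw [← ha] at h1
  have hu : associator y a x ∈ O := sub_mem (h.eo (h.ee hy hae) hx) (h.eo hy (h.eo hae hx))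
  generalize associator y a x = u at *
  have h2 := h.cyclic_odd hx hx hu
  have h3 : x * u = -(u * x) := by rw [h1, neg_neg]
  simp only [associator, ← ha, h3, neg_mul, mul_neg] at h2
  linear_combination (norm := abel) -h2

theorem associator_comm_sq_of_odd (h : IsSuperMinusOneOne E O) (hx : x ∈ O) (ha : a = x * x)
    (hy : y ∈ O) : associator y a x * a = a * associator y a x := by
  have h1 := h.associator_mul_comm_of_odd hx hy
  have hae : a ∈ E := ha ▸ h.oo hx hx
  rw [← ha] at h1
  have hu : associator y a x ∈ E := sub_mem (h.oo (h.oe hy hae) hx) (h.oo hy (h.eo hae hx))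
  generalize associator y a x = u at *
  have h2 := h.cyclic_two_odd hu hx hx
  simp only [associator, ← ha, ← h1] at h2
  linear_combination (norm := abel) -h2

/-- By `key`, `2 (y, a, x) x` is a combination of `(ya, x, x)`, `(y, x, x) a` and `(yx, a, x)`, and
each of these commutes with `a`. For the middle one, `v = (y, x, x)` commutes with `a` and `(a, v,
a) = 0`. -/
theorem associator_mul_comm_sq (h : IsSuperMinusOneOne E O) (hx : x ∈ O) (ha : a = x * x)
    (hy : y ∈ E) : associator y a x * x * a = a * (associator y a x * x) := by
  obtain ⟨b, hb⟩ : ∃ b, b = a * x := ⟨_, rfl⟩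
  have hae : a ∈ E := ha ▸ h.oo hx hx
  have hyx : y * x ∈ O := h.eo hy hx
  have h1 := h.associator_comm_sq_of_odd hx ha hyx
  have h2 := h.associator_mul_sq_comm hx (h.ee hy hae)
  have h3 := h.associator_mul_sq_comm hx hy
  have hv : associator y x x ∈ E := sub_mem (h.oo hyx hx) (h.ee hy (h.oo hx hx))
  have h4 := h.associator_sq_even_sq hx hv
  rw [← ha] at h2 h3 h4
  have h5 : associator y x x * a * a = a * (associator y x x * a) := by
    rwa [associator, sub_eq_zero, ← h3] at h4
  have e1 := congrArg (· * x) (h.two_mul_cube hx ha hb (.inl hy))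
  have e2 := h.two_mul_cube hx ha hb (.inr hyx)
  have key : (2 : ℤ) • (associator y a x * x) = associator (y * a) x x - associator y x x * a
      - (2 : ℤ) • associator (y * x) a x := by
    simp only [add_mul] at e1
    linear_combination (norm := (simp only [associator, ← ha, ← hb, smul_sub, sub_mul]; abel))
      -e1 - e2
  refine eq_of_zsmul_sub_eq_zero (n := 2) (by decide) ?_
  rw [smul_sub, ← smul_mul_assoc (2 : ℤ) (associator y a x * x) a, ← mul_smul_comm (2 : ℤ) a, key]
  simp only [sub_mul, mul_sub, h2, h5, smul_mul_assoc, mul_smul_comm, h1, sub_self]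

/-- In operator form, `D² = 0` on even elements. The value `u = D y` anticommutes with `x` and
commutes with `a`, `ua` anticommutes with `x`, and `ux` commutes with `a`. Under these rules the
right alternative identities in `u, x, a` force `6 (u, a, x) = 0`. -/
theorem associator_associator (h : IsSuperMinusOneOne E O) (hx : x ∈ O) (ha : a = x * x)
    (hy : y ∈ E) : associator (associator y a x) a x = 0 := by
  obtain ⟨b, hb⟩ : ∃ b, b = a * x := ⟨_, rfl⟩
  have hae : a ∈ E := ha ▸ h.oo hx hx
  have hb' : x * a = b := by rw [hb, ha, h.mul_sq_self hx]
  have h1 := h.associator_mul_anticomm_of_even hx hy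
  have h2 := h.associator_comm_sq_of_even hx ha hy
  have h3 := h.associator_mul_anticomm_of_even hx (h.ee hy hae)
  have h4 := h.associator_mul_comm_sq hx ha hy
  rw [← ha] at h1 h3
  rw [h.associator_mul_left hx ha (.inl hy)] at h3
  have hu : associator y a x ∈ O := sub_mem (h.eo (h.ee hy hae) hx) (h.eo hy (h.eo hae hx))
  generalize associator y a x = u at *
  have hxu : x * u = -(u * x) := by rw [h1, neg_neg]
  have e1 := h.right_alt_odd (.inl hae) hx hu
  have e2 := h.right_alt_even (.inr hx) (.inr hu) hae
  have e3 := h.right_alt_even (.inr hu) (.inr hx) hae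
  simp only [associator, ← hb, hb', hxu, ← h2, mul_neg, neg_mul] at e1 e2 e3
  refine eq_of_zsmul_sub_eq_zero (n := 6) (by decide) ?_
  linear_combination (norm := (simp only [associator, ← hb, smul_sub, smul_add]; abel))
    e2 - e1 + (3 : ℤ) • e3 + (2 : ℤ) • h3 - (2 : ℤ) • h4

/-- The operator `C = [R_x², R_{x²}]` commutes with `R_{x²}` on even elements. -/
theorem commutator_commutator (h : IsSuperMinusOneOne E O) (hx : x ∈ O) (ha : a = x * x)
    (hy : y ∈ E) : y * x * x * a * a + y * a * a * x * x =
      y * a * x * x * a + y * a * x * x * a := by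
  obtain ⟨b, hb⟩ : ∃ b, b = a * x := ⟨_, rfl⟩
  have hae : a ∈ E := ha ▸ h.oo hx hx
  have hyx : y * x ∈ O := h.eo hy hx
  have hya : y * a ∈ E := h.ee hy hae
  -- Here `two` says that `2D` is the commutator of `R_a` and `R_x`, and `comm` says that `D`
  -- commutes with `R_a`. Hence `[R_a, R_x²]` is `2 (D R_x + R_x D)`, and its commutator with `R_a`
  -- is a multiple of `D²`, which kills the even element `y`.
  have two : ∀ {z}, z ∈ E ∨ z ∈ O → (2 : ℤ) • associator z a x = z * a * x - z * x * a := by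
    intro z hz
    have := h.two_mul_cube hx ha hb hz
    linear_combination (norm := (simp only [associator, ← hb, smul_sub]; abel)) -this
  have comm : ∀ {z}, z ∈ E ∨ z ∈ O →
      z * a * a * x + z * x * a * a = z * a * x * a + z * a * x * a := by
    intro z hz
    have e1 := two hz
    have e2 := two (z := z * a) (hz.imp (h.ee · hae) (h.oe · hae))
    rw [h.associator_mul_left hx ha hz, ← smul_mul_assoc, e1, sub_mul] at e2
    linear_combination (norm := abel) -e2
  have hu : associator y a x ∈ O := sub_mem (h.eo hya hx) (h.eo hy (h.eo hae hx))
  have e1 := two (.inr hu)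
  rw [h.associator_associator hx ha hy, smul_zero] at e1
  have e2 : (2 : ℤ) • (associator y a x * a * x - associator y a x * x * a) = 0 := by
    rw [← e1, smul_zero]
  simp only [smul_sub, ← smul_mul_assoc, two (.inl hy), sub_mul] at e2
  have e3 := congrArg (· * x) (comm (.inl hy))
  simp only [add_mul] at e3
  have e4 := comm (.inr hyx)
  linear_combination (norm := abel) e3 + e4 + e2 + e2

end IsSuperMinusOneOne

/-! ### Sign rules in the Grassmann algebra. -/

namespace Grassmann

variable {Φ : Type u} [Field Φ]

theorem ι_mul_ι (v w : ℕ →₀ Φ) : ExteriorAlgebra.ι Φ v * ExteriorAlgebra.ι Φ w =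
    -(ExteriorAlgebra.ι Φ w * ExteriorAlgebra.ι Φ v) :=
  eq_neg_of_add_eq_zero_left (ExteriorAlgebra.ι_add_mul_swap v w)

theorem commute_of_mem_zero {g : Grassmann Φ} (hg : g ∈ part Φ 0) (h : Grassmann Φ) :
    g * h = h * g := by
  have key : ∀ (v w : ℕ →₀ Φ) (h : Grassmann Φ),
      Commute (ExteriorAlgebra.ι Φ v * ExteriorAlgebra.ι Φ w) h := by
    intro v w h
    induction h using ExteriorAlgebra.induction with
    | algebraMap r => exact Algebra.commute_algebraMap_right r _
    | ι m =>
      change _ * _ = _ * _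
      rw [mul_assoc, ι_mul_ι w m, mul_neg, ← mul_assoc, ι_mul_ι v m, neg_mul, neg_neg, mul_assoc]
    | mul a b ha hb => exact ha.mul_right hb
    | add a b ha hb => exact ha.add_right hb
  induction g, hg using CliffordAlgebra.even_induction with
  | algebraMap r => exact Algebra.commutes r h
  | add x y _ _ hx hy => rw [add_mul, mul_add, hx, hy]
  | ι_mul_ι_mul m₁ m₂ x _ hx => exact ((key m₁ m₂ h).mul_left hx : Commute _ _)

theorem anticommute_of_mem_one {g h : Grassmann Φ} (hg : g ∈ part Φ 1) (hh : h ∈ part Φ 1) :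
    g * h = -(h * g) := by
  have key : ∀ v w : ℕ →₀ Φ, CliffordAlgebra.ι (0 : QuadraticForm Φ (ℕ →₀ Φ)) v *
      CliffordAlgebra.ι _ w ∈ part Φ 0 := CliffordAlgebra.ι_mul_ι_mem_evenOdd_zero _
  induction g, hg using CliffordAlgebra.odd_induction with
  | ι v =>
    induction h, hh using CliffordAlgebra.odd_induction with
    | ι w => exact ι_mul_ι v w
    | add x y _ _ hx hy => rw [add_mul, mul_add, hx, hy, neg_add]
    | ι_mul_ι_mul m₁ m₂ x _ hx =>
      rw [← mul_assoc, ← commute_of_mem_zero (key m₁ m₂), mul_assoc, hx, mul_neg, ← mul_assoc]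
  | add x y _ _ hx hy => rw [add_mul, mul_add, hx, hy, neg_add]
  | ι_mul_ι_mul m₁ m₂ x _ hx =>
    rw [mul_assoc, hx, mul_neg, commute_of_mem_zero (key m₁ m₂), mul_assoc,
      ← commute_of_mem_zero (key m₁ m₂)]

theorem mul_self_of_mem_one [CharZero Φ] {g : Grassmann Φ} (hg : g ∈ part Φ 1) : g * g = 0 := by
  have h := add_eq_zero_iff_eq_neg.2 (anticommute_of_mem_one hg hg)
  rw [← two_smul Φ, smul_eq_zero] at h
  exact h.resolve_left two_ne_zero

/-- The sign `(-1)^{ij}`. -/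
def sign (i j : ZMod 2) : ℤ := (-1) ^ (i.val * j.val)

theorem sign_comm (i j : ZMod 2) : sign i j = sign j i := by rw [sign, sign, mul_comm]

theorem mul_comm_sign {i j : ZMod 2} {g h : Grassmann Φ} (hg : g ∈ part Φ i) (hh : h ∈ part Φ j) :
    h * g = sign i j • (g * h) := by
  have key : ∀ i : ZMod 2, i = 0 ∨ i = 1 := by decide
  rcases key i with rfl | rfl
  · simp [sign, commute_of_mem_zero hg]
  · rcases key j with rfl | rfl
    · simp [sign, commute_of_mem_zero hh]
    · have : (1 : ZMod 2).val = 1 := rfl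
      simp [sign, this, anticommute_of_mem_one hg hh]

theorem mul_mem {i j : ZMod 2} {g h : Grassmann Φ} (hg : g ∈ part Φ i) (hh : h ∈ part Φ j) :
    g * h ∈ part Φ (i + j) := SetLike.mul_mem_graded hg hh

end Grassmann

/-! ### Passing between `(-1,1)`-algebras and superalgebras by tensoring with `G`. -/

section Span

variable {Φ : Type u} [Field Φ] {T : Type v} [NonUnitalNonAssocRing T] [Module Φ T]
  [IsScalarTower Φ T T] [SMulCommClass Φ T T]

/-- A linear identity between associators extends from spanning sets to their spans. -/
theorem associator_identity_span {S₁ S₂ S₃ : Set T} (n₁ n₂ n₃ n₄ : ℤ)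
    (h : ∀ a ∈ S₁, ∀ b ∈ S₂, ∀ c ∈ S₃, n₁ • associator a b c + n₂ • associator a c b +
      n₃ • associator b c a + n₄ • associator c a b = 0) {a b c : T}
    (ha : a ∈ Submodule.span Φ S₁) (hb : b ∈ Submodule.span Φ S₂)
    (hc : c ∈ Submodule.span Φ S₃) :
    n₁ • associator a b c + n₂ • associator a c b +
      n₃ • associator b c a + n₄ • associator c a b = 0 := by
  induction ha using Submodule.span_induction with
  | zero => simp [associator]
  | add a a' _ _ h₁ h₂ =>
    refine Eq.trans ?_ ((congrArg₂ (· + ·) h₁ h₂).trans (add_zero 0))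
    simp only [associator, add_mul, mul_add, smul_sub, smul_add]; abel
  | smul r a _ h₁ =>
    refine Eq.trans ?_ ((congrArg (r • ·) h₁).trans (smul_zero r))
    simp only [associator, smul_mul_assoc, mul_smul_comm, smul_sub, smul_add, smul_comm r]
  | mem a ha =>
    induction hb using Submodule.span_induction with
    | zero => simp [associator]
    | add a a' _ _ h₁ h₂ =>
      refine Eq.trans ?_ ((congrArg₂ (· + ·) h₁ h₂).trans (add_zero 0))
      simp only [associator, add_mul, mul_add, smul_sub, smul_add]; abel
    | smul r a _ h₁ =>
      refine Eq.trans ?_ ((congrArg (r • ·) h₁).trans (smul_zero r))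
      simp only [associator, smul_mul_assoc, mul_smul_comm, smul_sub, smul_add, smul_comm r]
    | mem b hb =>
      induction hc using Submodule.span_induction with
      | zero => simp [associator]
      | add a a' _ _ h₁ h₂ =>
        refine Eq.trans ?_ ((congrArg₂ (· + ·) h₁ h₂).trans (add_zero 0))
        simp only [associator, add_mul, mul_add, smul_sub, smul_add]; abel
      | smul r a _ h₁ =>
        refine Eq.trans ?_ ((congrArg (r • ·) h₁).trans (smul_zero r))
        simp only [associator, smul_mul_assoc, mul_smul_comm, smul_sub, smul_add, smul_comm r]
      | mem c hc => exact h a ha b hb c hc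

theorem mul_mem_span {S₁ S₂ S₃ : Set T} (h : ∀ a ∈ S₁, ∀ b ∈ S₂, a * b ∈ S₃) {a b : T}
    (ha : a ∈ Submodule.span Φ S₁) (hb : b ∈ Submodule.span Φ S₂) :
    a * b ∈ Submodule.span Φ S₃ := by
  induction ha, hb using Submodule.span_induction₂ with
  | mem_mem a b ha hb => exact Submodule.subset_span (h a ha b hb)
  | zero_left y hy => rw [zero_mul]; exact Submodule.zero_mem _
  | zero_right x hx => rw [mul_zero]; exact Submodule.zero_mem _
  | add_left x y z _ _ _ h₁ h₂ => rw [add_mul]; exact Submodule.add_mem _ h₁ h₂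
  | add_right x y z _ _ _ h₁ h₂ => rw [mul_add]; exact Submodule.add_mem _ h₁ h₂
  | smul_left r x y _ _ h => rw [smul_mul_assoc]; exact Submodule.smul_mem _ _ h
  | smul_right r x y _ _ h => rw [mul_smul_comm]; exact Submodule.smul_mem _ _ h

end Span

section Tensor

variable {Φ : Type u} [Field Φ] {A : Type v} [NonUnitalNonAssocRing A] [Module Φ A]
  [IsScalarTower Φ A A] [SMulCommClass Φ A A]

theorem associator_tmul (a b c : A) (g h k : Grassmann Φ) :
    associator (a ⊗ₜ[Φ] g) (b ⊗ₜ[Φ] h) (c ⊗ₜ[Φ] k) = associator a b c ⊗ₜ[Φ] (g * h * k) := by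
  simp only [associator, Algebra.TensorProduct.tmul_mul_tmul, mul_assoc, TensorProduct.sub_tmul]

theorem isMinusOneOne_linearized {N : Type*} [NonUnitalNonAssocRing N] (hN : IsMinusOneOne N)
    (a b c : N) : associator a b c + associator a c b = 0 := by
  have h1 := hN.1 a (b + c)
  have h2 := hN.1 a b
  have h3 := hN.1 a c
  simp only [associator, mul_add, add_mul] at *
  linear_combination (norm := abel) h1 - h2 - h3

open Grassmann in
/-- The super identities of a tensor product `N ⊗ G`. -/
theorem isMinusOneOne_tmul_sign {N : NonUnitalSubalgebra Φ A} (hN : IsMinusOneOne N)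
    {i j k : ZMod 2} {a b c : A} (ha : a ∈ N) (hb : b ∈ N) (hc : c ∈ N) {g h l : Grassmann Φ}
    (hg : g ∈ part Φ i) (hh : h ∈ part Φ j) (hl : l ∈ part Φ k) :
    associator (a ⊗ₜ[Φ] g) (b ⊗ₜ h) (c ⊗ₜ l) +
        sign j k • associator (a ⊗ₜ[Φ] g) (c ⊗ₜ l) (b ⊗ₜ h) = 0 ∧
      associator (a ⊗ₜ[Φ] g) (b ⊗ₜ h) (c ⊗ₜ l) +
        sign i (j + k) • associator (b ⊗ₜ[Φ] h) (c ⊗ₜ l) (a ⊗ₜ g) +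
        sign k (i + j) • associator (c ⊗ₜ[Φ] l) (a ⊗ₜ g) (b ⊗ₜ h) = 0 := by
  have h1 : associator a b c + associator a c b = 0 :=
    congrArg Subtype.val (isMinusOneOne_linearized hN ⟨a, ha⟩ ⟨b, hb⟩ ⟨c, hc⟩)
  have h2 : associator a b c + associator b c a + associator c a b = 0 :=
    congrArg Subtype.val (hN.2 ⟨a, ha⟩ ⟨b, hb⟩ ⟨c, hc⟩)
  have sq : ∀ i j : ZMod 2, sign i j * sign i j = 1 := by decide
  have e1 : g * l * h = sign j k • (g * h * l) := by
    rw [mul_assoc, mul_comm_sign hh hl, mul_smul_comm, mul_assoc]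
  have e2 : h * l * g = sign i (j + k) • (g * h * l) := by
    rw [mul_comm_sign hg (mul_mem hh hl), mul_assoc]
  have e3 : l * g * h = sign k (i + j) • (g * h * l) := by
    rw [mul_assoc, mul_comm_sign (mul_mem hg hh) hl, sign_comm]
  simp only [associator_tmul, e1, e2, e3, TensorProduct.tmul_smul, smul_smul, sq, one_smul]
  rw [← TensorProduct.add_tmul, ← TensorProduct.add_tmul, ← TensorProduct.add_tmul, h1, h2]
  simp

/-- The homogeneous components of `N ⊗ G` inside `A ⊗ G`. -/
noncomputable def tensorPart (N : NonUnitalSubalgebra Φ A) (i : ZMod 2) :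
    Submodule Φ (A ⊗[Φ] Grassmann Φ) :=
  Submodule.span Φ {t : A ⊗[Φ] Grassmann Φ | ∃ a ∈ N, ∃ g ∈ Grassmann.part Φ i, t = a ⊗ₜ[Φ] g}

theorem mul_mem_tensorPart {N : NonUnitalSubalgebra Φ A} {i j : ZMod 2}
    {s t : A ⊗[Φ] Grassmann Φ} (hs : s ∈ tensorPart N i) (ht : t ∈ tensorPart N j) :
    s * t ∈ tensorPart N (i + j) := by
  refine mul_mem_span ?_ hs ht
  rintro _ ⟨a, ha, g, hg, rfl⟩ _ ⟨b, hb, h, hh, rfl⟩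
  exact ⟨a * b, N.mul_mem ha hb, g * h, Grassmann.mul_mem hg hh,
    Algebra.TensorProduct.tmul_mul_tmul a b g h⟩

open Grassmann in
theorem isMinusOneOne_tensorPart_sign {N : NonUnitalSubalgebra Φ A} (hN : IsMinusOneOne N)
    (i j k : ZMod 2) {s t r : A ⊗[Φ] Grassmann Φ} (hs : s ∈ tensorPart N i)
    (ht : t ∈ tensorPart N j) (hr : r ∈ tensorPart N k) :
    associator s t r + sign j k • associator s r t = 0 ∧
      associator s t r + sign i (j + k) • associator t r s +
        sign k (i + j) • associator r s t = 0 := by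
  constructor
  · have := associator_identity_span 1 (sign j k) 0 0 ?_ hs ht hr
    · simpa only [one_smul, zero_smul, add_zero] using this
    · rintro _ ⟨a, ha, g, hg, rfl⟩ _ ⟨b, hb, h, hh, rfl⟩ _ ⟨c, hc, l, hl, rfl⟩
      simpa only [one_smul, zero_smul, add_zero] using
        (isMinusOneOne_tmul_sign hN ha hb hc hg hh hl).1
  · have := associator_identity_span 1 0 (sign i (j + k)) (sign k (i + j)) ?_ hs ht hr
    · simpa only [one_smul, zero_smul, add_zero] using this
    · rintro _ ⟨a, ha, g, hg, rfl⟩ _ ⟨b, hb, h, hh, rfl⟩ _ ⟨c, hc, l, hl, rfl⟩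
      simpa only [one_smul, zero_smul, add_zero] using
        (isMinusOneOne_tmul_sign hN ha hb hc hg hh hl).2

open Grassmann in
/-- If `N` is a `(-1,1)`-algebra, then `N ⊗ G` is a `(-1,1)`-superalgebra for the grading of `G`. -/
theorem isSuperMinusOneOne_tensor {N : NonUnitalSubalgebra Φ A} (hN : IsMinusOneOne N) :
    IsSuperMinusOneOne (tensorPart N 0).toAddSubgroup (tensorPart N 1).toAddSubgroup := by
  have hra := @isMinusOneOne_tensorPart_sign Φ _ A _ _ _ _ N hN
  have s00 : sign 0 0 = 1 := rfl
  have s01 : sign 0 1 = 1 := rfl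
  have s10 : sign 1 0 = 1 := rfl
  have s11 : sign 1 1 = -1 := rfl
  have o2 : (1 : ZMod 2) + 1 = 0 := rfl
  constructor
  · exact fun ha hb => mul_mem_tensorPart (i := 0) (j := 0) ha hb
  · exact fun ha hb => mul_mem_tensorPart (i := 0) (j := 1) ha hb
  · exact fun ha hb => mul_mem_tensorPart (i := 1) (j := 0) ha hb
  · exact fun ha hb => mul_mem_tensorPart (i := 1) (j := 1) ha hb
  · rintro a b c (ha | ha) (hb | hb) hc
    · simpa [s00] using (hra 0 0 0 ha hb hc).1
    · simpa [s10] using (hra 0 1 0 ha hb hc).1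
    · simpa [s00] using (hra 1 0 0 ha hb hc).1
    · simpa [s10] using (hra 1 1 0 ha hb hc).1
  · rintro a b c (ha | ha) hb hc
    · simpa [s11, ← sub_eq_add_neg] using (hra 0 1 1 ha hb hc).1
    · simpa [s11, ← sub_eq_add_neg] using (hra 1 1 1 ha hb hc).1
  · rintro a b c (ha | ha) hb hc
    · simpa [s00] using (hra 0 0 0 ha hb hc).2
    · simpa [s10, s01] using (hra 1 0 0 ha hb hc).2
  · intro a b c ha hb hc
    simpa [s11, s00, o2, ← sub_eq_add_neg] using (hra 0 1 1 ha hb hc).2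
  · intro a b c ha hb hc
    simpa [s10, o2] using (hra 1 1 1 ha hb hc).2

open Grassmann in
/-- A superalgebra satisfying the super identities is a `(-1,1)`-superalgebra. -/
theorem Superalgebra.isMinusOneOne_of_sign [CharZero Φ] (V : Superalgebra.{u, v} Φ)
    (h : ∀ (i j k : ZMod 2), ∀ a ∈ V.part i, ∀ b ∈ V.part j, ∀ c ∈ V.part k,
      associator a b c + sign j k • associator a c b = 0 ∧
      associator a b c + sign i (j + k) • associator b c a +
        sign k (i + j) • associator c a b = 0) : V.IsMinusOneOne := by
  have hlin : ∀ s ∈ V.envelope, ∀ t ∈ V.envelope, ∀ r ∈ V.envelope,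
      associator s t r + associator s r t = 0 ∧
      associator s t r + associator t r s + associator r s t = 0 := by
    intro s hs t ht r hr
    have e : ∀ {i j k : ZMod 2} {g p l : Grassmann Φ}, g ∈ Grassmann.part Φ i →
        p ∈ Grassmann.part Φ j → l ∈ Grassmann.part Φ k → g * l * p = sign j k • (g * p * l) ∧
          p * l * g = sign i (j + k) • (g * p * l) ∧ l * g * p = sign k (i + j) • (g * p * l) := by
      intro i j k g p l hg hp hl
      refine ⟨?_, ?_, ?_⟩
      · rw [mul_assoc, mul_comm_sign hp hl, mul_smul_comm, mul_assoc]
      · rw [mul_comm_sign hg (Grassmann.mul_mem hp hl), mul_assoc]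
      · rw [mul_assoc, mul_comm_sign (Grassmann.mul_mem hg hp) hl, sign_comm]
    constructor
    · have := associator_identity_span 1 1 0 0 ?_ hs ht hr
      · simpa using this
      · rintro _ ⟨i, a, ha, g, hg, rfl⟩ _ ⟨j, b, hb, p, hp, rfl⟩ _ ⟨k, c, hc, l, hl, rfl⟩
        obtain ⟨e1, e2, e3⟩ := e hg hp hl
        simp only [associator_tmul, e1, one_smul, zero_smul, add_zero]
        rw [← TensorProduct.smul_tmul, ← TensorProduct.add_tmul, (h i j k a ha b hb c hc).1,
          TensorProduct.zero_tmul]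
    · have := associator_identity_span 1 0 1 1 ?_ hs ht hr
      · simpa using this
      · rintro _ ⟨i, a, ha, g, hg, rfl⟩ _ ⟨j, b, hb, p, hp, rfl⟩ _ ⟨k, c, hc, l, hl, rfl⟩
        obtain ⟨e1, e2, e3⟩ := e hg hp hl
        simp only [associator_tmul, e2, e3, one_smul, zero_smul, add_zero]
        rw [← TensorProduct.smul_tmul, ← TensorProduct.smul_tmul, ← TensorProduct.add_tmul,
          ← TensorProduct.add_tmul, (h i j k a ha b hb c hc).2, TensorProduct.zero_tmul]
  constructor
  · intro s t
    have := (hlin s.1 s.2 t.1 t.2 t.1 t.2).1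
    rw [← two_smul Φ, smul_eq_zero] at this
    exact Subtype.ext (this.resolve_left two_ne_zero)
  · exact fun s t r => Subtype.ext (hlin s.1 s.2 t.1 t.2 r.1 r.2).2

end Tensor

/-! ### The test word and a model in which it never vanishes. -/

section Word

/-- The sequence `x², x² C, x² C², …`, where `C = [R_{x²}, R_x²]` and `R` denotes right
multiplication. -/
def commutatorWord {T : Type*} [NonUnitalNonAssocRing T] (x : T) : ℕ → T
  | 0 => x * x
  | r + 1 => commutatorWord x r * (x * x) * x * x - commutatorWord x r * x * x * (x * x)

theorem map_commutatorWord {T T' F : Type*} [NonUnitalNonAssocRing T] [NonUnitalNonAssocRing T']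
    [FunLike F T T'] [NonUnitalRingHomClass F T T'] (f : F) (x : T) (r : ℕ) :
    f (commutatorWord x r) = commutatorWord (f x) r := by
  induction r with
  | zero => simp [commutatorWord]
  | succ r ih => simp [commutatorWord, ih]

end Word

/-- The underlying space `Φ[t] ⊕ Φ[t]` of a superalgebra of vector type. -/
structure VectorType (Φ : Type u) [Field Φ] where
  even : Polynomial Φ
  odd : Polynomial Φ

namespace VectorType

open Polynomial

variable {Φ : Type u} [Field Φ]

@[ext]
theorem ext' {p q : VectorType Φ} (h₁ : p.even = q.even) (h₂ : p.odd = q.odd) : p = q := by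
  cases p; cases q; simp_all

noncomputable instance : Zero (VectorType Φ) := ⟨⟨0, 0⟩⟩
noncomputable instance : Add (VectorType Φ) := ⟨fun p q => ⟨p.even + q.even, p.odd + q.odd⟩⟩
noncomputable instance : Neg (VectorType Φ) := ⟨fun p => ⟨-p.even, -p.odd⟩⟩
noncomputable instance : Sub (VectorType Φ) := ⟨fun p q => ⟨p.even - q.even, p.odd - q.odd⟩⟩
noncomputable instance : SMul Φ (VectorType Φ) := ⟨fun c p => ⟨c • p.even, c • p.odd⟩⟩

-- For `x = (0, 1)` this product gives `x² = (t, 0)`. On even elements `R_{x²}` is multiplication by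
-- `t` and `R_x²` is `p ↦ tp + 2p'`, so the two generate a Weyl algebra.
noncomputable instance : Mul (VectorType Φ) :=
  ⟨fun p q => ⟨p.even * q.even + (X * p.odd * q.odd + 2 * derivative p.odd * q.odd +
    p.odd * derivative q.odd), p.even * q.odd + p.odd * q.even⟩⟩

@[simp] theorem even_zero : (0 : VectorType Φ).even = 0 := rfl
@[simp] theorem odd_zero : (0 : VectorType Φ).odd = 0 := rfl
@[simp] theorem even_add (p q : VectorType Φ) : (p + q).even = p.even + q.even := rfl
@[simp] theorem odd_add (p q : VectorType Φ) : (p + q).odd = p.odd + q.odd := rfl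
@[simp] theorem even_neg (p : VectorType Φ) : (-p).even = -p.even := rfl
@[simp] theorem odd_neg (p : VectorType Φ) : (-p).odd = -p.odd := rfl
@[simp] theorem even_sub (p q : VectorType Φ) : (p - q).even = p.even - q.even := rfl
@[simp] theorem odd_sub (p q : VectorType Φ) : (p - q).odd = p.odd - q.odd := rfl
@[simp] theorem even_smul (c : Φ) (p : VectorType Φ) : (c • p).even = c • p.even := rfl
@[simp] theorem odd_smul (c : Φ) (p : VectorType Φ) : (c • p).odd = c • p.odd := rfl
@[simp] theorem even_mul (p q : VectorType Φ) : (p * q).even = p.even * q.even +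
    (X * p.odd * q.odd + 2 * derivative p.odd * q.odd + p.odd * derivative q.odd) := rfl
@[simp] theorem odd_mul (p q : VectorType Φ) :
    (p * q).odd = p.even * q.odd + p.odd * q.even := rfl

noncomputable instance : AddCommGroup (VectorType Φ) where
  add_assoc _ _ _ := by ext1 <;> simp [add_assoc]
  zero_add _ := by ext1 <;> simp
  add_zero _ := by ext1 <;> simp
  add_comm _ _ := by ext1 <;> simp [add_comm]
  neg_add_cancel _ := by ext1 <;> simp
  sub_eq_add_neg _ _ := by ext1 <;> simp [sub_eq_add_neg]
  nsmul := nsmulRec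
  zsmul := zsmulRec

noncomputable instance : NonUnitalNonAssocRing (VectorType Φ) where
  left_distrib _ _ _ := by ext1 <;> simp <;> ring
  right_distrib _ _ _ := by ext1 <;> simp <;> ring
  zero_mul _ := by ext1 <;> simp
  mul_zero _ := by ext1 <;> simp

noncomputable instance : Module Φ (VectorType Φ) where
  one_smul _ := by ext1 <;> simp
  mul_smul _ _ _ := by ext1 <;> simp [mul_smul]
  smul_zero _ := by ext1 <;> simp
  smul_add _ _ _ := by ext1 <;> simp
  add_smul _ _ _ := by ext1 <;> simp [add_smul]
  zero_smul _ := by ext1 <;> simp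

instance : IsScalarTower Φ (VectorType Φ) (VectorType Φ) where
  smul_assoc c p q := by
    ext1 <;> simp [smul_eq_C_mul] <;> ring

instance : SMulCommClass Φ (VectorType Φ) (VectorType Φ) where
  smul_comm c p q := by
    ext1 <;> simp [smul_eq_C_mul] <;> ring

variable (Φ) in
/-- The even and odd part. -/
def part (i : ZMod 2) : Submodule Φ (VectorType Φ) where
  carrier := {p | (i = 0 → p.odd = 0) ∧ (i = 1 → p.even = 0)}
  zero_mem' := by simp
  add_mem' hp hq := ⟨fun h => by simp [hp.1 h, hq.1 h], fun h => by simp [hp.2 h, hq.2 h]⟩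
  smul_mem' c p hp := ⟨fun h => by simp [hp.1 h], fun h => by simp [hp.2 h]⟩

theorem mem_part_zero {p : VectorType Φ} : p ∈ part Φ 0 ↔ p.odd = 0 :=
  ⟨fun h => h.1 rfl, fun h => ⟨fun _ => h, fun h => absurd h (by decide)⟩⟩

theorem mem_part_one {p : VectorType Φ} : p ∈ part Φ 1 ↔ p.even = 0 :=
  ⟨fun h => h.2 rfl, fun h => ⟨fun h => absurd h (by decide), fun _ => h⟩⟩

theorem zero_or_one : ∀ i : ZMod 2, i = 0 ∨ i = 1 := by decide

variable (Φ) in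
/-- The superalgebra of vector type on `Φ[t] ⊕ Φ[t]` given by `d/dt` and `t`. -/
noncomputable def superalgebra : Superalgebra.{u, u} Φ where
  carrier := VectorType Φ
  part := part Φ
  isCompl := by
    constructor
    · rw [Submodule.disjoint_def]
      exact fun p h₀ h₁ => ext' (mem_part_one.1 h₁) (mem_part_zero.1 h₀)
    · rw [codisjoint_iff, eq_top_iff]
      refine fun p _ => Submodule.mem_sup.2 ⟨⟨p.even, 0⟩, mem_part_zero.2 rfl, ⟨0, p.odd⟩,
        mem_part_one.2 rfl, ?_⟩
      ext1 <;> simp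
  mul_mem := by
    have o2 : (1 : ZMod 2) + 1 = 0 := rfl
    intro i j p q hp hq
    rcases zero_or_one i with rfl | rfl <;> rcases zero_or_one j with rfl | rfl <;>
      simp only [mem_part_zero, mem_part_one, add_zero, zero_add, o2] at * <;> simp [hp, hq]

theorem isMinusOneOne [CharZero Φ] : (superalgebra Φ).IsMinusOneOne := by
  refine Superalgebra.isMinusOneOne_of_sign _ ?_
  change ∀ i j k : ZMod 2, ∀ a ∈ part Φ i, ∀ b ∈ part Φ j, ∀ c ∈ part Φ k, _
  have o2 : (1 : ZMod 2) + 1 = 0 := rfl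
  have s00 : Grassmann.sign 0 0 = 1 := rfl
  have s01 : Grassmann.sign 0 1 = 1 := rfl
  have s10 : Grassmann.sign 1 0 = 1 := rfl
  have s11 : Grassmann.sign 1 1 = -1 := rfl
  rintro i j k ⟨a₀, a₁⟩ ha ⟨b₀, b₁⟩ hb ⟨c₀, c₁⟩ hc
  change (associator (⟨a₀, a₁⟩ : VectorType Φ) ⟨b₀, b₁⟩ ⟨c₀, c₁⟩ +
      Grassmann.sign j k • associator (⟨a₀, a₁⟩ : VectorType Φ) ⟨c₀, c₁⟩ ⟨b₀, b₁⟩ = 0) ∧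
    (associator (⟨a₀, a₁⟩ : VectorType Φ) ⟨b₀, b₁⟩ ⟨c₀, c₁⟩ +
      Grassmann.sign i (j + k) • associator (⟨b₀, b₁⟩ : VectorType Φ) ⟨c₀, c₁⟩ ⟨a₀, a₁⟩ +
      Grassmann.sign k (i + j) • associator (⟨c₀, c₁⟩ : VectorType Φ) ⟨a₀, a₁⟩ ⟨b₀, b₁⟩ = 0)
  rcases zero_or_one i with rfl | rfl <;> rcases zero_or_one j with rfl | rfl <;>
    rcases zero_or_one k with rfl | rfl <;>
    simp only [mem_part_zero, mem_part_one] at ha hb hc <;> subst ha hb hc <;>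
    simp only [add_zero, zero_add, o2, s00, s01, s10, s11, one_smul, neg_smul] <;>
    constructor <;> ext1 <;> simp [associator] <;> ring

/-- On even elements `C` sends `p` to `t(tp) + 2(tp)' - t(tp + 2p') = 2p`, and the word starts at
`x² = t`. -/
theorem commutatorWord_one (r : ℕ) :
    commutatorWord (⟨0, 1⟩ : VectorType Φ) r = ⟨2 ^ r * X, 0⟩ := by
  have hd : ∀ r, derivative ((2 : Φ[X]) ^ r * X) = 2 ^ r := by
    intro r
    have : (2 : Φ[X]) ^ r = C (2 ^ r) := by rw [map_pow, map_ofNat]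
    rw [this, derivative_C_mul, derivative_X, mul_one]
  induction r with
  | zero => simp only [commutatorWord]; ext1 <;> simp
  | succ r ih =>
    rw [commutatorWord, ih]
    ext1 <;> simp [hd, pow_succ] <;> ring

end VectorType

theorem commutatorWord_gen_ne_zero (Φ : Type u) [Field Φ] [CharZero Φ] (r : ℕ) :
    commutatorWord (FreeMinusOneOne.gen Φ) r ≠ 0 := by
  intro h
  obtain ⟨φ, ⟨hφ, -⟩, -⟩ := FreeMinusOneOne.existsUnique_lift (VectorType.superalgebra Φ)
    VectorType.isMinusOneOne (⟨0, 1⟩ : VectorType Φ) (VectorType.mem_part_one.2 rfl)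
  have h1 := congrArg φ h
  rw [map_commutatorWord, hφ, map_zero] at h1
  have h2 := congrArg VectorType.even ((VectorType.commutatorWord_one r).symm.trans h1)
  have h3 : (2 : Polynomial Φ) ^ r * Polynomial.X = 0 := h2
  exact mul_ne_zero (pow_ne_zero r two_ne_zero) Polynomial.X_ne_zero h3

/-! ### Nilpotency of a commutator that commutes with an integral operator. -/

section Nilpotent

open Polynomial

theorem _root_.Commute.aeval_left {K R : Type*} [CommRing K] [Ring R] [Algebra K R] {A C : R}
    (hAC : Commute A C) (q : K[X]) : Commute (aeval A q) C := by
  induction q using Polynomial.induction_on' with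
  | add p q hp hq => rw [map_add]; exact hp.add_left hq
  | monomial n c =>
    rw [aeval_monomial]
    exact (Algebra.commute_algebraMap_left c C).mul_left (hAC.pow_left n)

/-- The derivation `[P, ·]` sends `A` to `C`, which commutes with `A`; on polynomials in `A` it is
therefore formal differentiation followed by multiplication by `C`. -/
theorem mul_aeval_sub_aeval_mul {K R : Type*} [CommRing K] [Ring R] [Algebra K R] {A P C : R}
    (hC : P * A - A * P = C) (hAC : Commute A C) (q : K[X]) :
    P * aeval A q - aeval A q * P = aeval A (derivative q) * C := by
  induction q using Polynomial.induction_on' with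
  | add p q hp hq =>
    simp only [map_add, mul_add, add_mul, ← hp, ← hq]
    abel
  | monomial n c =>
    have key : ∀ n : ℕ, P * A ^ n - A ^ n * P = n • (A ^ (n - 1) * C) := by
      intro n
      induction n with
      | zero => simp
      | succ n ih =>
        have h1 : P * A ^ (n + 1) - A ^ (n + 1) * P =
            (P * A ^ n - A ^ n * P) * A + A ^ n * (P * A - A * P) := by
          rw [pow_succ]; noncomm_ring
        rw [h1, ih, hC, smul_mul_assoc, mul_assoc, ← hAC.eq, ← mul_assoc, add_smul, one_smul,
          Nat.add_sub_cancel]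
        rcases n with _ | n
        · simp
        · rw [Nat.add_sub_cancel, ← pow_succ]
    rw [aeval_monomial, derivative_monomial, aeval_monomial, ← mul_assoc, ← Algebra.commutes c P,
      mul_assoc, mul_assoc, ← mul_sub, key, map_mul, map_natCast, mul_assoc, mul_assoc,
      nsmul_eq_mul]

/-- If `C = [P, A]` commutes with `A` and `A` is integral, then `C` is nilpotent. -/
theorem commutator_pow_eq_zero {K R : Type*} [CommRing K] [Ring R] [Algebra K R] {A P C : R}
    (hC : P * A - A * P = C) (hAC : Commute A C) {p : K[X]} (hp : p.Monic) (hpA : aeval A p = 0)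
    (hu : IsUnit ((p.natDegree.factorial : ℕ) : K)) : C ^ (2 ^ p.natDegree - 1) = 0 := by
  -- Induction: multiply `q(A) C^r = 0` on the left by `P` and move `P` past `q(A)`, which yields
  -- `q'(A) C^(r+1)` plus a term `q(A) P C^r`. A further left factor `C^r` kills that term, since it
  -- commutes with `q(A)`, and leaves exponent `2r + 1`. After `deg p` derivatives only the
  -- invertible constant `(deg p)!` remains.
  have key : ∀ k : ℕ, aeval A (derivative^[k] p) * C ^ (2 ^ k - 1) = 0 := by
    intro k
    induction k with
    | zero => simp [hpA]
    | succ k ih =>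
      set r := 2 ^ k - 1 with hr
      have hk : 2 ^ (k + 1) - 1 = r + (1 + r) := by
        have := Nat.one_le_two_pow (n := k)
        omega
      set q := derivative^[k] p
      have hcomm : ∀ s : K[X], Commute (C ^ r) (aeval A s) := fun s =>
        (hAC.aeval_left s).symm.pow_left r
      have h1 := congrArg (P * ·) ih
      have h2 := mul_aeval_sub_aeval_mul hC hAC q
      rw [sub_eq_iff_eq_add'] at h2
      simp only [mul_zero, ← mul_assoc, h2, add_mul] at h1
      have h3 := congrArg (C ^ r * ·) h1
      simp only [mul_add, mul_zero, ← mul_assoc] at h3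
      rw [(hcomm q).eq, ih, zero_mul, zero_mul, zero_add, (hcomm _).eq] at h3
      rw [Function.iterate_succ_apply', hk, pow_add, pow_add, pow_one, ← mul_assoc, ← mul_assoc]
      exact h3
  have h := key p.natDegree
  have h1 : derivative^[p.natDegree] p = Polynomial.C ((p.natDegree.factorial : ℕ) : K) := by
    ext i
    rw [coeff_iterate_derivative, coeff_C]
    split_ifs with hi
    · subst hi
      rw [zero_add, coeff_natDegree, hp.leadingCoeff, Nat.descFactorial_self, nsmul_one]
    · rw [coeff_eq_zero_of_natDegree_lt (by omega), smul_zero]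
  rw [h1, aeval_C] at h
  exact (hu.map (algebraMap K R)).mul_right_eq_zero.1 h

/-- The generator bound is available on `M`, the commutation on `S`, and `M ⊓ S` need not be
finitely generated. Cayley–Hamilton is therefore applied on `M`; the resulting monic equation of
degree at most `n` restricts to `M ⊓ S`, where the previous theorem applies. -/
theorem commutator_pow_apply_eq_zero {K V : Type*} [CommRing K] [AddCommGroup V]
    [Module K V] (hK : ∀ n : ℕ, IsUnit ((n.factorial : ℕ) : K))
    {A P : Module.End K V} {M S : Submodule K V} {n : ℕ}
    (hM : ∃ s : Finset V, s.card ≤ n ∧ Submodule.span K (s : Set V) = M)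
    (hAM : ∀ v ∈ M, A v ∈ M) (hPM : ∀ v ∈ M, P v ∈ M)
    (hAS : ∀ v ∈ S, A v ∈ S) (hPS : ∀ v ∈ S, P v ∈ S)
    (hcomm : ∀ v ∈ S, A ((P * A - A * P) v) = (P * A - A * P) (A v)) {v : V}
    (hvM : v ∈ M) (hvS : v ∈ S) : ((P * A - A * P) ^ (2 ^ n - 1)) v = 0 := by
  obtain ⟨s, hs, hspan⟩ := hM
  have hfin : Module.Finite K M := Module.Finite.iff_fg.2 ⟨s, hspan⟩
  obtain ⟨p, hp, hdeg, hpA⟩ :=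
    LinearMap.exists_monic_and_natDegree_eq_and_aeval_eq_zero K (A.restrict hAM)
  have hle : p.natDegree ≤ n := by
    rw [hdeg, Submodule.spanFinrank_top, ← hspan]
    refine (Submodule.spanFinrank_span_le_ncard_of_finite s.finite_toSet).trans ?_
    rwa [Set.ncard_coe_finset]
  have hAN : ∀ v ∈ M ⊓ S, A v ∈ M ⊓ S := fun v hv => ⟨hAM v hv.1, hAS v hv.2⟩
  have hPN : ∀ v ∈ M ⊓ S, P v ∈ M ⊓ S := fun v hv => ⟨hPM v hv.1, hPS v hv.2⟩
  have hres : ∀ (N : Submodule K V) (hN : ∀ v ∈ N, A v ∈ N) (q : K[X]) (v : N),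
      (aeval (A.restrict hN) q v : V) = aeval A q v := by
    intro N hN q v
    induction q using Polynomial.induction_on' with
    | add p q hp hq => simp [hp, hq]
    | monomial k c =>
      rw [aeval_monomial, aeval_monomial, Module.End.mul_apply, Module.End.mul_apply,
        Module.algebraMap_end_apply, Module.algebraMap_end_apply, Module.End.pow_restrict,
        Submodule.coe_smul, LinearMap.coe_restrict_apply]
  have hpA' : aeval (A.restrict hAN) p = 0 := by
    ext w
    rw [hres, ← hres M hAM p ⟨w, w.2.1⟩, hpA]
    rfl
  have hC : P.restrict hPN * A.restrict hAN - A.restrict hAN * P.restrict hPN =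
      (P * A - A * P).restrict (fun v hv => sub_mem (hPN _ (hAN _ hv)) (hAN _ (hPN _ hv))) := by
    ext w; rfl
  have h := commutator_pow_eq_zero hC (by ext w; exact hcomm w w.2.2) hp hpA' (hK _)
  have h' := congrArg (fun f => ((f ⟨v, hvM, hvS⟩ : (M ⊓ S : Submodule K V)) : V)) h
  rw [Module.End.pow_restrict] at h'
  have h2 : ((P * A - A * P) ^ (2 ^ p.natDegree - 1)) v = 0 := h'
  obtain ⟨k, hk⟩ : ∃ k, 2 ^ n - 1 = k + (2 ^ p.natDegree - 1) :=
    ⟨_, (Nat.sub_add_cancel (Nat.sub_le_sub_right (Nat.pow_le_pow_right two_pos hle) 1)).symm⟩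
  rw [hk, pow_add, Module.End.mul_apply, h2, map_zero]

end Nilpotent

/-! ### A stable module with a bounded number of generators. -/

section Bound

instance ExteriorAlgebra.finite_of_finite {Φ M : Type*} [Field Φ] [AddCommGroup M] [Module Φ M]
    [Module.Finite Φ M] : Module.Finite Φ (ExteriorAlgebra Φ M) := by
  have h1 : (⨆ i : ℕ, LinearMap.range (CliffordAlgebra.ι (0 : QuadraticForm Φ M)) ^ i) = ⊤ :=
    CliffordAlgebra.iSup_ι_range_eq_top _
  have h2 : (⨆ i : ℕ, LinearMap.range (CliffordAlgebra.ι (0 : QuadraticForm Φ M)) ^ i) ≤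
      ⨆ i : Fin (Module.finrank Φ M + 1), (⋀[Φ]^(i : ℕ) M : Submodule Φ (ExteriorAlgebra Φ M)) := by
    refine iSup_le fun i => ?_
    by_cases hi : i < Module.finrank Φ M + 1
    · exact le_iSup (fun i : Fin (Module.finrank Φ M + 1) =>
        (⋀[Φ]^(i : ℕ) M : Submodule Φ (ExteriorAlgebra Φ M))) ⟨i, hi⟩
    · have : Module.finrank Φ (⋀[Φ]^i M) = 0 := by
        rw [exteriorPower.finrank_eq, Nat.choose_eq_zero_of_lt (by omega)]
      have h3 : (⋀[Φ]^i M : Submodule Φ (ExteriorAlgebra Φ M)) = ⊥ :=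
        Submodule.finrank_eq_zero.1 this
      exact (le_of_eq h3).trans bot_le
  rw [h1, top_le_iff] at h2
  rw [Module.finite_def, ← h2]
  exact Submodule.fg_iSup _ fun i => Module.Finite.iff_fg.1 inferInstance

/-- Right multiplication by an element of `H ⊗ B`, linear over a subalgebra of `H`. -/
def mulRightLinear {Φ : Type*} [Field Φ] {H : Type*} [Ring H] [Algebra Φ H] {B : Type*}
    [NonUnitalNonAssocRing B] [Module Φ B] [IsScalarTower Φ B B] [SMulCommClass Φ B B]
    (K : Subalgebra Φ H) (t : H ⊗[Φ] B) : H ⊗[Φ] B →ₗ[K] H ⊗[Φ] B where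
  toFun v := v * t
  map_add' v w := add_mul v w t
  map_smul' k v := smul_mul_assoc k v t

variable {Φ : Type*} [Field Φ] {H : Type*} [Ring H] [Algebra Φ H] {B : Type*}
  [NonUnitalNonAssocRing B] [Module Φ B] [IsScalarTower Φ B B] [SMulCommClass Φ B B]

omit [IsScalarTower Φ B B] [SMulCommClass Φ B B] in
theorem exists_eq_sum_tmul_basis {ι : Type*} [Fintype ι] (b : Module.Basis ι Φ B)
    (X : Submodule Φ H) {t : H ⊗[Φ] B}
    (ht : t ∈ Submodule.span Φ {t : H ⊗[Φ] B | ∃ g ∈ X, ∃ c : B, t = g ⊗ₜ[Φ] c}) :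
    ∃ γ : ι → H, (∀ j, γ j ∈ X) ∧ t = ∑ j, γ j ⊗ₜ[Φ] b j := by
  induction ht using Submodule.span_induction with
  | mem t ht =>
    obtain ⟨g, hg, c, rfl⟩ := ht
    refine ⟨fun j => b.repr c j • g, fun j => X.smul_mem _ hg, ?_⟩
    simp only [TensorProduct.smul_tmul, ← TensorProduct.tmul_sum, b.sum_repr]
  | zero => exact ⟨0, fun _ => X.zero_mem, by simp⟩
  | add s t _ _ hs ht =>
    obtain ⟨γ, hγ, rfl⟩ := hs
    obtain ⟨δ, hδ, rfl⟩ := ht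
    exact ⟨γ + δ, fun j => X.add_mem (hγ j) (hδ j), by
      simp [TensorProduct.add_tmul, Finset.sum_add_distrib]⟩
  | smul c t _ ht =>
    obtain ⟨γ, hγ, rfl⟩ := ht
    exact ⟨c • γ, fun j => X.smul_mem _ (hγ j), by
      simp [TensorProduct.smul_tmul', Finset.smul_sum]⟩

/-- If the coefficients of `ξ ∈ H ⊗ B` belong to two subspaces `X₀`, `X₁` of `H` whose elements
commute up to prescribed signs, then right multiplications by polynomials in `ξ` preserve a
submodule with a bounded number of generators over the commutative ring generated by `X₁`. -/
theorem exists_stable_submodule [Module.Finite Φ B] {X₀ X₁ : Submodule Φ H}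
    (h₀ : ∀ g ∈ X₀, g * g = 0) (h₀₁ : ∀ g ∈ X₀, ∀ k ∈ X₁, g * k = -(k * g)) {ξ : H ⊗[Φ] B}
    (hξ : ξ ∈ Submodule.span Φ {t : H ⊗[Φ] B | ∃ g ∈ X₀, ∃ c : B, t = g ⊗ₜ[Φ] c} ⊔
      Submodule.span Φ {t : H ⊗[Φ] B | ∃ g ∈ X₁, ∃ c : B, t = g ⊗ₜ[Φ] c}) :
    ∃ M : Submodule (Algebra.adjoin Φ (X₁ : Set H)) (H ⊗[Φ] B),
      (∃ s : Finset (H ⊗[Φ] B), s.card ≤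
        Module.finrank Φ (ExteriorAlgebra Φ (Fin (Module.finrank Φ B) → Φ)) *
          Module.finrank Φ B ∧ Submodule.span _ (s : Set (H ⊗[Φ] B)) = M) ∧
      ξ * ξ ∈ M ∧ (∀ v ∈ M, v * ξ ∈ M) ∧ ∀ v ∈ M, v * (ξ * ξ) ∈ M := by
  classical
  set K := Algebra.adjoin Φ (X₁ : Set H) with hKdef
  set b := Module.finBasis Φ B
  obtain ⟨ξ₀, hξ₀, ξ₁, hξ₁, rfl⟩ := Submodule.mem_sup.1 hξ
  obtain ⟨γ, hγ, rfl⟩ := exists_eq_sum_tmul_basis b X₀ hξ₀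
  let f : (Fin (Module.finrank Φ B) → Φ) →ₗ[Φ] H := Fintype.linearCombination Φ γ
  have hf : ∀ m, f m ∈ X₀ := fun m => by
    rw [Fintype.linearCombination_apply]
    exact X₀.sum_mem fun j _ => X₀.smul_mem _ (hγ j)
  have hfγ : ∀ j, f (Pi.single j 1) = γ j := fun j => by
    simp [f, Fintype.linearCombination_apply_single]
  -- The `X₀`-coefficients of `ξ` span a space of elements of square zero, so they generate an image
  -- of the exterior algebra on `dim B` generators. Its dimension does not depend on `ξ`, which is
  -- the source of the bound.
  let g := ExteriorAlgebra.lift Φ ⟨f, fun m => h₀ _ (hf m)⟩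
  have hgι : ∀ m, g (ExteriorAlgebra.ι Φ m) = f m := ExteriorAlgebra.lift_ι_apply Φ f _
  -- Moving `k` to the left past `g z` flips the sign of each generator; the twisted element `z'` is
  -- the same for all `k`. This lets right factors from `X₁` become scalars of `K`.
  have hgX : ∀ z, ∃ z', ∀ k ∈ X₁, g z * k = k * g z' := by
    intro z
    induction z using ExteriorAlgebra.induction with
    | algebraMap r =>
      exact ⟨algebraMap _ _ r, fun k _ => by rw [AlgHom.commutes, Algebra.commutes]⟩
    | ι m => exact ⟨-ExteriorAlgebra.ι Φ m, fun k hk => by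
        rw [map_neg, hgι, h₀₁ _ (hf m) k hk, mul_neg]⟩
    | mul a b ha hb =>
      obtain ⟨a', ha⟩ := ha
      obtain ⟨b', hb⟩ := hb
      exact ⟨a' * b', fun k hk => by
        rw [map_mul, mul_assoc, hb k hk, ← mul_assoc, ha k hk, map_mul, mul_assoc]⟩
    | add a b ha hb =>
      obtain ⟨a', ha⟩ := ha
      obtain ⟨b', hb⟩ := hb
      exact ⟨a' + b', fun k hk => by rw [map_add, add_mul, ha k hk, hb k hk, map_add, mul_add]⟩
  let W : Submodule K H := Submodule.span K (Set.range g)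
  -- The right stabiliser of `W` is closed under products and contains all coefficients of `ξ`,
  -- hence those of `ξ * ξ` too. It lies in `W` because `1 = g 1` does.
  let L : Set H := {h | ∀ w ∈ W, w * h ∈ W}
  have hL_of : ∀ h, (∀ z, g z * h ∈ W) → h ∈ L := by
    intro h hh w hw
    induction hw using Submodule.span_induction with
    | mem w hw => obtain ⟨z, rfl⟩ := hw; exact hh z
    | zero => rw [zero_mul]; exact W.zero_mem
    | add v w _ _ hv hw => rw [add_mul]; exact W.add_mem hv hw
    | smul k w _ hw => rw [smul_mul_assoc]; exact W.smul_mem k hw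
  have hLγ : ∀ j, γ j ∈ L := fun j => hL_of _ fun z => Submodule.subset_span
    ⟨z * ExteriorAlgebra.ι Φ (Pi.single j 1), by rw [map_mul, hgι, hfγ]⟩
  have hLX : ∀ k ∈ X₁, k ∈ L := fun k hk => hL_of _ fun z => by
    obtain ⟨z', hz⟩ := hgX z
    rw [hz k hk]
    exact W.smul_mem (⟨k, Algebra.subset_adjoin hk⟩ : K) (Submodule.subset_span ⟨z', rfl⟩)
  let LB := Submodule.span Φ {t : H ⊗[Φ] B | ∃ h ∈ L, ∃ c : B, t = h ⊗ₜ[Φ] c}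
  have hLB : ∀ s ∈ LB, ∀ t ∈ LB, s * t ∈ LB := by
    intro s hs t ht
    refine mul_mem_span ?_ hs ht
    rintro _ ⟨h, hh, c, rfl⟩ _ ⟨h', hh', c', rfl⟩
    exact ⟨h * h', fun w hw => by rw [← mul_assoc]; exact hh' _ (hh w hw), c * c',
      Algebra.TensorProduct.tmul_mul_tmul _ _ _ _⟩
  have hξL : ∑ j, γ j ⊗ₜ[Φ] b j + ξ₁ ∈ LB := by
    refine LB.add_mem (LB.sum_mem fun j _ => Submodule.subset_span ⟨_, hLγ j, _, rfl⟩) ?_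
    refine Submodule.span_mono ?_ hξ₁
    rintro _ ⟨k, hk, c, rfl⟩
    exact ⟨k, hLX k hk, c, rfl⟩
  let M : Submodule K (H ⊗[Φ] B) :=
    Submodule.span K {t | ∃ z, ∃ c : B, t = g z ⊗ₜ[Φ] c}
  have hWM : ∀ w ∈ W, ∀ c : B, w ⊗ₜ[Φ] c ∈ M := by
    intro w hw c
    induction hw using Submodule.span_induction with
    | mem w hw => obtain ⟨z, rfl⟩ := hw; exact Submodule.subset_span ⟨z, c, rfl⟩
    | zero => rw [TensorProduct.zero_tmul]; exact M.zero_mem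
    | add v w _ _ hv hw => rw [TensorProduct.add_tmul]; exact M.add_mem hv hw
    | smul k w _ hw => rw [← TensorProduct.smul_tmul']; exact M.smul_mem k hw
  have hML : ∀ v ∈ M, ∀ t ∈ LB, v * t ∈ M := by
    intro v hv t ht
    induction ht using Submodule.span_induction with
    | mem t ht =>
      obtain ⟨h, hh, c, rfl⟩ := ht
      induction hv using Submodule.span_induction with
      | mem v hv =>
        obtain ⟨z, c', rfl⟩ := hv
        rw [Algebra.TensorProduct.tmul_mul_tmul]
        exact hWM _ (hh _ (Submodule.subset_span ⟨z, rfl⟩)) _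
      | zero => rw [zero_mul]; exact M.zero_mem
      | add v w _ _ hv hw => rw [add_mul]; exact M.add_mem hv hw
      | smul k w _ hw => rw [smul_mul_assoc]; exact M.smul_mem k hw
    | zero => rw [mul_zero]; exact M.zero_mem
    | add s t _ _ hs ht => rw [mul_add]; exact M.add_mem hs ht
    | smul c t _ ht => rw [mul_smul_comm]; exact M.smul_of_tower_mem c ht
  have hLM : ∀ t ∈ LB, t ∈ M := by
    intro t ht
    induction ht using Submodule.span_induction with
    | mem t ht =>
      obtain ⟨h, hh, c, rfl⟩ := ht
      have : (1 : H) * h ∈ W := hh 1 (Submodule.subset_span ⟨1, map_one g⟩)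
      rw [one_mul] at this
      exact hWM h this c
    | zero => exact M.zero_mem
    | add s t _ _ hs ht => exact M.add_mem hs ht
    | smul c t _ ht => exact M.smul_of_tower_mem c ht
  refine ⟨M, ?_, hLM _ (hLB _ hξL _ hξL), fun v hv => hML v hv _ hξL,
    fun v hv => hML v hv _ (hLB _ hξL _ hξL)⟩
  let e := Module.finBasis Φ (ExteriorAlgebra Φ (Fin (Module.finrank Φ B) → Φ))
  refine ⟨Finset.univ.image fun p : Fin _ × Fin _ => g (e p.1) ⊗ₜ[Φ] b p.2, ?_, ?_⟩
  · exact Finset.card_image_le.trans (by simp)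
  · apply le_antisymm
    · rw [Submodule.span_le]
      intro t ht
      obtain ⟨p, -, rfl⟩ := Finset.mem_image.1 (Finset.mem_coe.1 ht)
      exact Submodule.subset_span ⟨_, _, rfl⟩
    · rw [Submodule.span_le]
      rintro _ ⟨z, c, rfl⟩
      rw [← e.sum_repr z, ← b.sum_repr c, map_sum, TensorProduct.sum_tmul]
      refine Submodule.sum_mem _ fun i _ => ?_
      rw [TensorProduct.tmul_sum]
      refine Submodule.sum_mem _ fun j _ => ?_
      rw [map_smul, TensorProduct.tmul_smul, ← TensorProduct.smul_tmul']
      refine Submodule.smul_of_tower_mem _ _ (Submodule.smul_of_tower_mem _ _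
        (Submodule.subset_span ?_))
      exact Finset.mem_coe.2 (Finset.mem_image.2 ⟨(i, j), Finset.mem_univ _, rfl⟩)

end Bound

/-! ### Vanishing of the word over a finite-dimensional algebra. -/

section Finite

theorem IsAddTorsionFree.of_module_charZero (Φ : Type*) [Field Φ] [CharZero Φ] (T : Type*)
    [AddCommGroup T] [Module Φ T] : IsAddTorsionFree T where
  nsmul_right_injective n hn a b h := by
    simp only [← Nat.cast_smul_eq_nsmul Φ] at h
    exact smul_right_injective T (Nat.cast_ne_zero.2 hn) h

theorem map_associator' {T T' F : Type*} [NonUnitalNonAssocRing T] [NonUnitalNonAssocRing T']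
    [FunLike F T T'] [NonUnitalRingHomClass F T T'] (f : F) (a b c : T) :
    associator (f a) (f b) (f c) = f (associator a b c) := by
  simp [associator]

theorem IsSuperMinusOneOne.map {T T' : Type*} [NonUnitalNonAssocRing T]
    [NonUnitalNonAssocRing T'] {E O : AddSubgroup T} (h : IsSuperMinusOneOne E O)
    (f : T →ₙ+* T') :
    IsSuperMinusOneOne (E.map (f : T →+ T')) (O.map (f : T →+ T')) := by
  have hor : ∀ {a : T'}, (a ∈ E.map (f : T →+ T') ∨ a ∈ O.map (f : T →+ T')) →
      ∃ a', (a' ∈ E ∨ a' ∈ O) ∧ f a' = a := by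
    rintro a (⟨a', ha, rfl⟩ | ⟨a', ha, rfl⟩)
    exacts [⟨a', .inl ha, rfl⟩, ⟨a', .inr ha, rfl⟩]
  have hE : ∀ {a : T'}, a ∈ E.map (f : T →+ T') → ∃ a' ∈ E, f a' = a := id
  have hO : ∀ {a : T'}, a ∈ O.map (f : T →+ T') → ∃ a' ∈ O, f a' = a := id
  constructor
  · rintro _ _ ⟨a, ha, rfl⟩ ⟨b, hb, rfl⟩
    exact ⟨a * b, h.ee ha hb, map_mul f a b⟩
  · rintro _ _ ⟨a, ha, rfl⟩ ⟨b, hb, rfl⟩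
    exact ⟨a * b, h.eo ha hb, map_mul f a b⟩
  · rintro _ _ ⟨a, ha, rfl⟩ ⟨b, hb, rfl⟩
    exact ⟨a * b, h.oe ha hb, map_mul f a b⟩
  · rintro _ _ ⟨a, ha, rfl⟩ ⟨b, hb, rfl⟩
    exact ⟨a * b, h.oo ha hb, map_mul f a b⟩
  · intro _ _ _ ha hb hc
    obtain ⟨a, ha', rfl⟩ := hor ha
    obtain ⟨b, hb', rfl⟩ := hor hb
    obtain ⟨c, hc', rfl⟩ := hE hc
    simp only [map_associator', ← map_add, h.right_alt_even ha' hb' hc', map_zero]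
  · intro _ _ _ ha hb hc
    obtain ⟨a, ha', rfl⟩ := hor ha
    obtain ⟨b, hb', rfl⟩ := hO hb
    obtain ⟨c, hc', rfl⟩ := hO hc
    simp only [map_associator', ← map_sub, h.right_alt_odd ha' hb' hc', map_zero]
  · intro _ _ _ ha hb hc
    obtain ⟨a, ha', rfl⟩ := hor ha
    obtain ⟨b, hb', rfl⟩ := hE hb
    obtain ⟨c, hc', rfl⟩ := hE hc
    simp only [map_associator', ← map_add, h.cyclic_even ha' hb' hc', map_zero]
  · intro _ _ _ ha hb hc
    obtain ⟨a, ha', rfl⟩ := hE ha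
    obtain ⟨b, hb', rfl⟩ := hO hb
    obtain ⟨c, hc', rfl⟩ := hO hc
    simp only [map_associator', ← map_add, ← map_sub, h.cyclic_two_odd ha' hb' hc', map_zero]
  · intro _ _ _ ha hb hc
    obtain ⟨a, ha', rfl⟩ := hO ha
    obtain ⟨b, hb', rfl⟩ := hO hb
    obtain ⟨c, hc', rfl⟩ := hO hc
    simp only [map_associator', ← map_add, h.cyclic_odd ha' hb' hc', map_zero]

open scoped IsMulCommutative in
/-- The word `commutatorWord ξ r` vanishes for an odd element `ξ` with coefficients in a
finite-dimensional algebra `B`, where `r` depends on the dimension of `B` only. -/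
theorem commutatorWord_eq_zero {Φ : Type*} [Field Φ] [CharZero Φ] {H : Type*} [Ring H]
    [Algebra Φ H] {B : Type*} [NonUnitalNonAssocRing B] [Module Φ B] [IsScalarTower Φ B B]
    [SMulCommClass Φ B B] [Module.Finite Φ B] {X₀ X₁ : Submodule Φ H}
    (h₀ : ∀ g ∈ X₀, g * g = 0) (h₀₁ : ∀ g ∈ X₀, ∀ k ∈ X₁, g * k = -(k * g))
    (h₁ : ∀ k ∈ X₁, ∀ l ∈ X₁, k * l = l * k) {ξ : H ⊗[Φ] B}
    (hξ : ξ ∈ Submodule.span Φ {t : H ⊗[Φ] B | ∃ g ∈ X₀, ∃ c : B, t = g ⊗ₜ[Φ] c} ⊔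
      Submodule.span Φ {t : H ⊗[Φ] B | ∃ g ∈ X₁, ∃ c : B, t = g ⊗ₜ[Φ] c})
    {E O : AddSubgroup (H ⊗[Φ] B)} (h : IsSuperMinusOneOne E O) (hξO : ξ ∈ O) :
    commutatorWord ξ (2 ^ (Module.finrank Φ
      (ExteriorAlgebra Φ (Fin (Module.finrank Φ B) → Φ)) * Module.finrank Φ B) - 1) = 0 := by
  have htf : IsAddTorsionFree (H ⊗[Φ] B) := .of_module_charZero Φ _
  obtain ⟨M, hM, hξM, hMξ, hMa⟩ := exists_stable_submodule h₀ h₀₁ hξ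
  have hcomm := Algebra.isMulCommutative_adjoin Φ h₁
  let A : Module.End (Algebra.adjoin Φ (X₁ : Set H)) (H ⊗[Φ] B) := mulRightLinear _ (ξ * ξ)
  let X : Module.End (Algebra.adjoin Φ (X₁ : Set H)) (H ⊗[Φ] B) := mulRightLinear _ ξ
  -- `E` is only an additive subgroup. The operators are `K`-linear, so the commutation known on `E`
  -- extends to its `K`-span.
  let S : Submodule (Algebra.adjoin Φ (X₁ : Set H)) (H ⊗[Φ] B) :=
    Submodule.span _ (E : Set (H ⊗[Φ] B))
  have hA : ∀ v, A v = v * (ξ * ξ) := fun _ => rfl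
  have hX : ∀ v, X v = v * ξ := fun _ => rfl
  have hξE : ξ * ξ ∈ E := h.oo hξO hξO
  have hS : ∀ f : Module.End (Algebra.adjoin Φ (X₁ : Set H)) (H ⊗[Φ] B), (∀ v ∈ E, f v ∈ E) →
      ∀ v ∈ S, f v ∈ S := by
    intro f hf v hv
    induction hv using Submodule.span_induction with
    | mem v hv => exact Submodule.subset_span (hf v hv)
    | zero => rw [map_zero]; exact S.zero_mem
    | add v w _ _ hv hw => rw [map_add]; exact S.add_mem hv hw
    | smul k v _ hv => rw [map_smul]; exact S.smul_mem k hv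
  have key := commutator_pow_apply_eq_zero (A := A) (P := X * X) (M := M) (S := S)
    (n := _) (v := ξ * ξ)
    (fun n => by
      have h1 : ((n.factorial : ℕ) : Algebra.adjoin Φ (X₁ : Set H)) =
          algebraMap Φ _ (n.factorial : ℕ) := by simp
      rw [h1]
      exact (IsUnit.mk0 _ (by exact_mod_cast Nat.factorial_ne_zero n)).map _)
    hM hMa (fun v hv => hMξ _ (hMξ v hv)) (hS A fun v hv => h.ee hv hξE)
    (hS (X * X) fun v hv => h.oo (h.eo hv hξO) hξO)
    (by
      have h1 : ∀ v ∈ S, (A * (X * X * A - A * (X * X))) v = ((X * X * A - A * (X * X)) * A) v :=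
        LinearMap.eqOn_span' fun v hv => by
          have := h.commutator_commutator hξO rfl hv
          simp only [Module.End.mul_apply, LinearMap.sub_apply, hA, hX, sub_mul]
          linear_combination (norm := abel) -this
      exact h1)
    hξM (Submodule.subset_span hξE)
  have hword : ∀ r, commutatorWord ξ r = ((X * X * A - A * (X * X)) ^ r) (ξ * ξ) := by
    intro r
    induction r with
    | zero => rfl
    | succ r ih =>
      rw [commutatorWord, ih, pow_succ', Module.End.mul_apply]
      rfl
  rw [hword]
  exact key

end Finite

/-! ### Regrouping tensor factors. -/

/-- A linear map on a tensor product is multiplicative if it is so on pure tensors. -/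
theorem LinearMap.map_mul_of_tmul {Φ : Type*} [Field Φ] {T G S : Type*} [NonUnitalNonAssocRing T]
    [Module Φ T] [IsScalarTower Φ T T] [SMulCommClass Φ T T] [Ring G] [Algebra Φ G]
    [NonUnitalNonAssocRing S] [Module Φ S] (f : T ⊗[Φ] G →ₗ[Φ] S)
    (h : ∀ s t g k, f ((s * t) ⊗ₜ[Φ] (g * k)) = f (s ⊗ₜ[Φ] g) * f (t ⊗ₜ[Φ] k))
    (a b : T ⊗[Φ] G) : f (a * b) = f a * f b := by
  induction a with
  | zero => simp only [zero_mul, map_zero]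
  | add s s' h₁ h₂ => simp only [add_mul, map_add, h₁, h₂]
  | tmul s g =>
    induction b with
    | zero => simp only [mul_zero, map_zero]
    | add t t' h₁ h₂ => simp only [mul_add, map_add, h₁, h₂]
    | tmul t k => rw [Algebra.TensorProduct.tmul_mul_tmul, h]

section Swap

variable {Φ : Type u} [Field Φ] {A : Type v} [NonUnitalNonAssocRing A] [Module Φ A]
  {G G' : Type*} [Ring G] [Algebra Φ G] [Ring G']
  [Algebra Φ G']

variable (Φ A G G') in
/-- The isomorphism `(A ⊗ G) ⊗ G' → (G ⊗ G') ⊗ A` of vector spaces. -/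
noncomputable def tensorSwapEquiv : (A ⊗[Φ] G) ⊗[Φ] G' ≃ₗ[Φ] (G ⊗[Φ] G') ⊗[Φ] A :=
  TensorProduct.assoc Φ A G G' ≪≫ₗ TensorProduct.comm Φ A (G ⊗[Φ] G')

theorem tensorSwapEquiv_tmul (a : A) (g : G) (h : G') :
    tensorSwapEquiv Φ A G G' ((a ⊗ₜ[Φ] g) ⊗ₜ[Φ] h) = (g ⊗ₜ[Φ] h) ⊗ₜ[Φ] a := rfl

variable [IsScalarTower Φ A A] [SMulCommClass Φ A A]

theorem tensorSwapEquiv_mul (s t : (A ⊗[Φ] G) ⊗[Φ] G') :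
    tensorSwapEquiv Φ A G G' (s * t) =
      tensorSwapEquiv Φ A G G' s * tensorSwapEquiv Φ A G G' t := by
  refine LinearMap.map_mul_of_tmul (tensorSwapEquiv Φ A G G').toLinearMap ?_ s t
  intro s t g g'
  simp only [LinearEquiv.coe_coe]
  induction s with
  | zero => simp only [TensorProduct.zero_tmul, zero_mul, map_zero]
  | add s s' h h' => simp only [TensorProduct.add_tmul, add_mul, map_add, h, h']
  | tmul a k =>
    induction t with
    | zero => simp only [TensorProduct.zero_tmul, mul_zero, map_zero]
    | add t t' h h' => simp only [TensorProduct.add_tmul, mul_add, map_add, h, h']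
    | tmul b l => simp only [Algebra.TensorProduct.tmul_mul_tmul, tensorSwapEquiv_tmul]

variable (Φ A G G') in
/-- The isomorphism `(A ⊗ G) ⊗ G' → (G ⊗ G') ⊗ A` of rings. -/
noncomputable def tensorSwap : (A ⊗[Φ] G) ⊗[Φ] G' →ₙ+* (G ⊗[Φ] G') ⊗[Φ] A where
  toFun := tensorSwapEquiv Φ A G G'
  map_zero' := map_zero _
  map_add' := map_add _
  map_mul' := tensorSwapEquiv_mul

theorem tensorSwap_tmul (a : A) (g : G) (h : G') :
    tensorSwap Φ A G G' ((a ⊗ₜ[Φ] g) ⊗ₜ[Φ] h) = (g ⊗ₜ[Φ] h) ⊗ₜ[Φ] a := rfl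

theorem tensorSwap_smul (c : Φ) (t : (A ⊗[Φ] G) ⊗[Φ] G') :
    tensorSwap Φ A G G' (c • t) = c • tensorSwap Φ A G G' t :=
  map_smul (tensorSwapEquiv Φ A G G') c t

theorem tensorSwap_injective : Function.Injective (tensorSwap Φ A G G') :=
  (tensorSwapEquiv Φ A G G').injective

/-- The word is homogeneous: it starts in degree `2` and each `C` adds `4`. Powers of `z` associate,
so every monomial carries the same factor from `H`. -/
theorem commutatorWord_tmul {H : Type*} [Ring H] [Algebra Φ H] (z : H) (y : A) (r : ℕ) :
    commutatorWord (z ⊗ₜ[Φ] y) r = (z ^ (4 * r + 2)) ⊗ₜ[Φ] commutatorWord y r := by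
  induction r with
  | zero => simp [commutatorWord, pow_two]
  | succ r ih =>
    have h : z ^ (4 * (r + 1) + 2) = z ^ (4 * r + 2) * z * z * z * z := by
      simp only [← pow_succ]
      congr 1
    have h' : z ^ (4 * r + 2) * (z * z) * z * z = z ^ (4 * (r + 1) + 2) ∧
        z ^ (4 * r + 2) * z * z * (z * z) = z ^ (4 * (r + 1) + 2) := by
      rw [h]; constructor <;> noncomm_ring
    simp only [commutatorWord, ih, Algebra.TensorProduct.tmul_mul_tmul, h'.1, h'.2,
      TensorProduct.tmul_sub]

end Swap

theorem tmul_ne_zero {Φ : Type*} [Field Φ] {V W : Type*} [AddCommGroup V] [Module Φ V]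
    [AddCommGroup W] [Module Φ W] {v : V} {w : W} (hv : v ≠ 0) (hw : w ≠ 0) :
    v ⊗ₜ[Φ] w ≠ 0 := by
  intro h
  obtain ⟨f, hf⟩ := Module.Projective.exists_dual_ne_zero Φ hv
  obtain ⟨g, hg⟩ := Module.Projective.exists_dual_ne_zero Φ hw
  have h1 := congrArg (LinearMap.mul' Φ Φ ∘ₗ TensorProduct.map f g) h
  simp only [LinearMap.comp_apply, TensorProduct.map_tmul, LinearMap.mul'_apply, map_zero] at h1
  exact mul_ne_zero hf hg h1

/-! ### Coefficients in `G ⊗ G` and the uniform bound. -/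

section Coefficients

variable (Φ : Type u) [Field Φ]

/-- The subspace `G_i ⊗ G₁` of `G ⊗ G`. -/
noncomputable def coefficientPart (i : ZMod 2) : Submodule Φ (Grassmann Φ ⊗[Φ] Grassmann Φ) :=
  Submodule.span Φ {t | ∃ g ∈ Grassmann.part Φ i, ∃ h ∈ Grassmann.part Φ 1, t = g ⊗ₜ[Φ] h}

variable {Φ}

open Grassmann in
-- The second factors are odd and contribute a sign of their own. Thus elements of `G₁ ⊗ G₁` commute
-- with each other, while elements of `G₀ ⊗ G₁` anticommute with each other and with `G₁ ⊗ G₁`, as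
-- `exists_stable_submodule` requires.
theorem coefficientPart_mul_comm {i j : ZMod 2} {s t : Grassmann Φ ⊗[Φ] Grassmann Φ}
    (hs : s ∈ coefficientPart Φ i) (ht : t ∈ coefficientPart Φ j) :
    s * t = -(sign i j • (t * s)) := by
  induction hs, ht using Submodule.span_induction₂ with
  | mem_mem s t hs ht =>
    obtain ⟨g, hg, h, hh, rfl⟩ := hs
    obtain ⟨g', hg', h', hh', rfl⟩ := ht
    rw [Algebra.TensorProduct.tmul_mul_tmul, Algebra.TensorProduct.tmul_mul_tmul,
      mul_comm_sign hg' hg, anticommute_of_mem_one hh hh', sign_comm, TensorProduct.tmul_neg,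
      TensorProduct.smul_tmul']
  | zero_left y hy => simp
  | zero_right x hx => simp
  | add_left x y z _ _ _ h₁ h₂ => rw [add_mul, mul_add, h₁, h₂, smul_add, neg_add]
  | add_right x y z _ _ _ h₁ h₂ => rw [add_mul, mul_add, h₁, h₂, smul_add, neg_add]
  | smul_left r x y _ _ h => rw [smul_mul_assoc, mul_smul_comm, h, smul_neg, smul_comm r]
  | smul_right r x y _ _ h => rw [smul_mul_assoc, mul_smul_comm, h, smul_neg, smul_comm r]

/-- The uniformity of `r` in `t` matters: the number of generators occurring in `t` is later chosen
in terms of `r`. -/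
theorem exists_commutatorWord_eq_zero [CharZero Φ] (B : Superalgebra.{u, v} Φ)
    [FiniteDimensional Φ B.carrier] (hB : B.IsMinusOneOne) :
    ∃ r, ∀ t ∈ tensorPart B.envelope 1, commutatorWord t r = 0 := by
  have s01 : Grassmann.sign 0 1 = 1 := rfl
  have s00 : Grassmann.sign 0 0 = 1 := rfl
  have s11 : Grassmann.sign 1 1 = -1 := rfl
  refine ⟨2 ^ (Module.finrank Φ (ExteriorAlgebra Φ (Fin (Module.finrank Φ B.carrier) → Φ)) *
    Module.finrank Φ B.carrier) - 1, fun t ht => ?_⟩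
  apply tensorSwap_injective
  rw [map_commutatorWord, map_zero]
  refine commutatorWord_eq_zero (X₀ := coefficientPart Φ 0) (X₁ := coefficientPart Φ 1)
    ?_ ?_ ?_ ?_
    ((isSuperMinusOneOne_tensor hB).map (tensorSwap Φ B.carrier (Grassmann Φ) (Grassmann Φ)))
    ⟨t, ht, rfl⟩
  · intro g hg
    have h := coefficientPart_mul_comm hg hg
    rw [s00, one_smul, ← add_eq_zero_iff_eq_neg, ← two_smul Φ, smul_eq_zero] at h
    exact h.resolve_left two_ne_zero
  · intro g hg k hk
    rw [coefficientPart_mul_comm hg hk, s01, one_smul]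
  · intro k hk l hl
    rw [coefficientPart_mul_comm hk hl, s11, neg_smul, neg_neg, one_smul]
  · have hmem : ∀ s ∈ B.envelope, ∀ g ∈ Grassmann.part Φ 1,
        tensorSwap Φ B.carrier (Grassmann Φ) (Grassmann Φ) (s ⊗ₜ[Φ] g) ∈
        Submodule.span Φ {t : (Grassmann Φ ⊗[Φ] Grassmann Φ) ⊗[Φ] B.carrier |
          ∃ g ∈ coefficientPart Φ 0, ∃ c : B.carrier, t = g ⊗ₜ[Φ] c} ⊔
        Submodule.span Φ {t : (Grassmann Φ ⊗[Φ] Grassmann Φ) ⊗[Φ] B.carrier |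
          ∃ g ∈ coefficientPart Φ 1, ∃ c : B.carrier, t = g ⊗ₜ[Φ] c} := by
      intro s hs g hg
      change s ∈ Submodule.span Φ _ at hs
      induction hs using Submodule.span_induction with
      | mem s hs =>
        obtain ⟨i, a, ha, h, hh, rfl⟩ := hs
        rw [tensorSwap_tmul]
        have hc : h ⊗ₜ[Φ] g ∈ coefficientPart Φ i := Submodule.subset_span ⟨h, hh, g, hg, rfl⟩
        rcases VectorType.zero_or_one i with rfl | rfl
        · exact Submodule.mem_sup_left (Submodule.subset_span ⟨_, hc, a, rfl⟩)
        · exact Submodule.mem_sup_right (Submodule.subset_span ⟨_, hc, a, rfl⟩)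
      | zero => rw [TensorProduct.zero_tmul, map_zero]; exact Submodule.zero_mem _
      | add s t _ _ hs ht =>
        rw [TensorProduct.add_tmul, map_add]
        exact Submodule.add_mem _ hs ht
      | smul c s _ hs =>
        rw [← TensorProduct.smul_tmul', tensorSwap_smul]
        exact Submodule.smul_mem _ c hs
    induction ht using Submodule.span_induction with
    | mem t ht =>
      obtain ⟨s, hs, g, hg, rfl⟩ := ht
      exact hmem s hs g hg
    | zero => rw [map_zero]; exact Submodule.zero_mem _
    | add s t _ _ hs ht => rw [map_add]; exact Submodule.add_mem _ hs ht
    | smul c s _ hs => rw [tensorSwap_smul]; exact Submodule.smul_mem _ c hs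

end Coefficients

/-! ### Powers of `∑ eᵢ ⊗ eᵢ`. -/

section Diagonal

variable (Φ : Type u) [Field Φ]

/-- The generators of the Grassmann algebra. -/
noncomputable def Grassmann.generator (i : ℕ) : Grassmann Φ :=
  ExteriorAlgebra.ι Φ (Finsupp.single i 1)

theorem Grassmann.generator_mem (i : ℕ) : Grassmann.generator Φ i ∈ Grassmann.part Φ 1 :=
  CliffordAlgebra.ι_mem_evenOdd_one _ _

/-- The product `e₀ e₁ ⋯ e_{d-1}` of generators of the Grassmann algebra. -/
noncomputable def Grassmann.generatorProd : ℕ → Grassmann Φ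
  | 0 => 1
  | d + 1 => Grassmann.generatorProd d * Grassmann.generator Φ d

theorem Grassmann.generatorProd_ne_zero (d : ℕ) : Grassmann.generatorProd Φ d ≠ 0 := by
  have h1 : Grassmann.generatorProd Φ d =
      ExteriorAlgebra.ιMulti Φ d fun i : Fin d => Finsupp.single (i : ℕ) (1 : Φ) := by
    rw [ExteriorAlgebra.ιMulti_apply]
    induction d with
    | zero => simp [Grassmann.generatorProd]
    | succ d ih =>
      rw [Grassmann.generatorProd, ih, List.ofFn_succ', List.concat_eq_append, List.prod_append]
      simp [Grassmann.generator]
  intro h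
  -- The determinant of the first `d` coordinates is an alternating form with value `1` on the
  -- generators, so it detects their product.
  let coords : (ℕ →₀ Φ) →ₗ[Φ] (Fin d → Φ) := LinearMap.pi fun i => Finsupp.lapply (i : ℕ)
  let f : ∀ i, (ℕ →₀ Φ) [⋀^Fin i]→ₗ[Φ] Φ := fun i =>
    if hi : i = d then hi ▸ (Matrix.detRowAlternating (R := Φ) (n := Fin d)).compLinearMap coords
    else 0
  have h2 := ExteriorAlgebra.liftAlternating_apply_ιMulti f
    fun i : Fin d => Finsupp.single (i : ℕ) (1 : Φ)
  rw [← h1, h, map_zero] at h2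
  have h3 : f d = (Matrix.detRowAlternating (R := Φ) (n := Fin d)).compLinearMap coords := by
    simp [f]
  rw [h3] at h2
  have h4 : (fun i : Fin d => coords (Finsupp.single (i : ℕ) (1 : Φ))) =
      (1 : Matrix (Fin d) (Fin d) Φ) := by
    ext i j
    simp [coords, Matrix.one_apply, Finsupp.single_apply, Fin.ext_iff]
  have h5 : Matrix.det (fun i : Fin d => coords (Finsupp.single (i : ℕ) (1 : Φ))) = 0 := h2.symm
  rw [h4, Matrix.det_one] at h5
  exact one_ne_zero h5

/-- The element `e₀ ⊗ e₀ + ⋯ + e_{d-1} ⊗ e_{d-1}` of `G ⊗ G`. -/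
noncomputable def diagonalSum (d : ℕ) : Grassmann Φ ⊗[Φ] Grassmann Φ :=
  ∑ i ∈ Finset.range d, Grassmann.generator Φ i ⊗ₜ[Φ] Grassmann.generator Φ i

theorem add_pow_succ_of_sq_zero {R : Type*} [Ring R] {z w : R} (h : Commute z w) (hw : w * w = 0)
    (k : ℕ) : (z + w) ^ (k + 1) = z ^ (k + 1) + (k + 1) • (z ^ k * w) := by
  induction k with
  | zero => simp
  | succ k ih =>
    have h1 : z ^ k * w * w = 0 := by rw [mul_assoc, hw, mul_zero]
    have h2 : z ^ k * w * z = z ^ (k + 1) * w := by rw [mul_assoc, ← h.eq, ← mul_assoc, pow_succ]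
    rw [pow_succ, ih, add_mul, mul_add, mul_add, smul_mul_assoc, smul_mul_assoc, h1, h2,
      smul_zero, add_zero, ← pow_succ, add_assoc, add_comm (z ^ (k + 1) * w), ← succ_nsmul]

/-- The summands commute and square to zero, so only the product of all of them survives in the
`d`-th power, once for each ordering. The vanishing of the next power is carried along to drop the
leading term in the inductive step. -/
theorem diagonalSum_pow [CharZero Φ] (d : ℕ) : diagonalSum Φ d ^ (d + 1) = 0 ∧
    diagonalSum Φ d ^ d =
      d.factorial • (Grassmann.generatorProd Φ d ⊗ₜ[Φ] Grassmann.generatorProd Φ d) := by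
  have hmem : ∀ i, Grassmann.generator Φ i ⊗ₜ[Φ] Grassmann.generator Φ i ∈ coefficientPart Φ 1 :=
    fun i => Submodule.subset_span
      ⟨_, Grassmann.generator_mem Φ i, _, Grassmann.generator_mem Φ i, rfl⟩
  induction d with
  | zero => simp [diagonalSum, Grassmann.generatorProd, Algebra.TensorProduct.one_def]
  | succ d ih =>
    obtain ⟨ih₁, ih₂⟩ := ih
    have hw : (Grassmann.generator Φ d ⊗ₜ[Φ] Grassmann.generator Φ d) *
        (Grassmann.generator Φ d ⊗ₜ[Φ] Grassmann.generator Φ d) = 0 := by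
      rw [Algebra.TensorProduct.tmul_mul_tmul,
        Grassmann.mul_self_of_mem_one (Grassmann.generator_mem Φ d), TensorProduct.tmul_zero]
    have hc : Commute (diagonalSum Φ d)
        (Grassmann.generator Φ d ⊗ₜ[Φ] Grassmann.generator Φ d) := by
      have := coefficientPart_mul_comm (Submodule.sum_mem _ fun i (_ : i ∈ Finset.range d) =>
        hmem i) (hmem d)
      rwa [show Grassmann.sign 1 1 = -1 from rfl, neg_smul, neg_neg, one_smul] at this
    have hs : diagonalSum Φ (d + 1) = diagonalSum Φ d +
      Grassmann.generator Φ d ⊗ₜ[Φ] Grassmann.generator Φ d := Finset.sum_range_succ _ _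
    rw [hs, add_pow_succ_of_sq_zero hc hw, add_pow_succ_of_sq_zero hc hw, pow_succ _ (d + 1), ih₁,
      ih₂]
    refine ⟨by simp, ?_⟩
    rw [zero_add, smul_mul_assoc, Algebra.TensorProduct.tmul_mul_tmul, smul_smul,
      Nat.factorial_succ]
    rfl

theorem diagonalSum_pow_ne_zero [CharZero Φ] (d : ℕ) : diagonalSum Φ d ^ d ≠ 0 := by
  rw [(diagonalSum_pow Φ d).2, ← Nat.cast_smul_eq_nsmul Φ]
  refine smul_ne_zero (Nat.cast_ne_zero.2 (Nat.factorial_ne_zero d)) ?_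
  exact tmul_ne_zero (Grassmann.generatorProd_ne_zero Φ d) (Grassmann.generatorProd_ne_zero Φ d)

end Diagonal

/-! ### From the word in `A ⊗ G` to ordinary polynomial identities. -/

section Slice

variable {Φ : Type*} [Field Φ] {A : Type*} [NonUnitalNonAssocRing A] [Module Φ A]
  {A' : Type*} [NonUnitalNonAssocRing A'] [Module Φ A']

/-- The contraction of the second factor of `A ⊗ G` by a linear form. -/
noncomputable def tensorSlice (φ : Module.Dual Φ (Grassmann Φ)) : A ⊗[Φ] Grassmann Φ →ₗ[Φ] A :=
  (TensorProduct.rid Φ A).toLinearMap ∘ₗ LinearMap.lTensor A φ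

theorem eq_zero_of_tensorSlice {t : A ⊗[Φ] Grassmann Φ} (h : ∀ φ, tensorSlice φ t = 0) : t = 0 := by
  classical
  let e := Module.Basis.ofVectorSpace Φ (Grassmann Φ)
  apply (TensorProduct.equivFinsuppOfBasisRight e).injective
  rw [map_zero]
  ext k
  have key : ∀ s : A ⊗[Φ] Grassmann Φ,
      TensorProduct.equivFinsuppOfBasisRight e s k = tensorSlice (e.coord k) s := by
    intro s
    induction s with
    | zero => simp
    | add s t hs ht => simp only [map_add, Finsupp.add_apply, hs, ht]
    | tmul a g => simp [tensorSlice]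
  rw [key, h, Finsupp.zero_apply]

variable (Φ) in
/-- The element `s₀ ⊗ e₀ + ⋯ + s_{d-1} ⊗ e_{d-1}` of `A ⊗ G`. -/
noncomputable def generatorSum (s : ℕ → A) (d : ℕ) : A ⊗[Φ] Grassmann Φ :=
  ∑ i ∈ Finset.range d, s i ⊗ₜ[Φ] Grassmann.generator Φ i

variable [IsScalarTower Φ A A] [SMulCommClass Φ A A] [IsScalarTower Φ A' A']
  [SMulCommClass Φ A' A']

/-- A homomorphism of algebras `A → A'` extended to `A ⊗ G → A' ⊗ G`. -/
noncomputable def rTensorHom (f : A →ₙₐ[Φ] A') :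
    A ⊗[Φ] Grassmann Φ →ₙ+* A' ⊗[Φ] Grassmann Φ where
  toFun := LinearMap.rTensor (Grassmann Φ) (f : A →ₗ[Φ] A')
  map_zero' := map_zero _
  map_add' := map_add _
  map_mul' := LinearMap.map_mul_of_tmul _ fun s t g k => by simp

theorem rTensorHom_tmul (f : A →ₙₐ[Φ] A') (a : A) (g : Grassmann Φ) :
    rTensorHom f (a ⊗ₜ[Φ] g) = f a ⊗ₜ[Φ] g := rfl

theorem tensorSlice_rTensorHom (φ : Module.Dual Φ (Grassmann Φ)) (f : A →ₙₐ[Φ] A')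
    (t : A ⊗[Φ] Grassmann Φ) : tensorSlice φ (rTensorHom f t) = f (tensorSlice φ t) := by
  induction t with
  | zero => simp only [map_zero]
  | add s t hs ht => simp only [map_add, hs, ht]
  | tmul a g => simp [tensorSlice, rTensorHom_tmul]

theorem rTensorHom_generatorSum (f : A →ₙₐ[Φ] A') (s : ℕ → A) (d : ℕ) :
    rTensorHom f (generatorSum Φ s d) = generatorSum Φ (fun i => f (s i)) d := by
  rw [generatorSum, map_sum]
  rfl

end Slice

section Identities

variable {Φ : Type u} [Field Φ]

/-- The coefficients of `commutatorWord (x₀ ⊗ e₀ + ⋯ + x_{d-1} ⊗ e_{d-1}) r`. -/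
noncomputable def wordPolynomial (r d : ℕ) (φ : Module.Dual Φ (Grassmann Φ)) :
    FreeNonUnitalNonAssocAlgebra Φ ℕ :=
  tensorSlice φ (commutatorWord (generatorSum Φ (FreeNonUnitalNonAssocAlgebra.of Φ) d) r)

/-- Substitution acts on the first tensor factor and contraction on the second, so they commute. All
the `wordPolynomial`s vanish under a substitution exactly when the word vanishes on the
corresponding odd element. -/
theorem lift_wordPolynomial {A : Type*} [NonUnitalNonAssocRing A] [Module Φ A]
    [IsScalarTower Φ A A] [SMulCommClass Φ A A] (N : NonUnitalSubalgebra Φ A) (s : ℕ → N)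
    (r d : ℕ) (φ : Module.Dual Φ (Grassmann Φ)) :
    (FreeNonUnitalNonAssocAlgebra.lift Φ s (wordPolynomial r d φ) : A) =
      tensorSlice φ (commutatorWord (generatorSum Φ (fun i => (s i : A)) d) r) := by
  have h := tensorSlice_rTensorHom φ ((NonUnitalSubalgebraClass.subtype N).comp
    (FreeNonUnitalNonAssocAlgebra.lift Φ s))
    (commutatorWord (generatorSum Φ (FreeNonUnitalNonAssocAlgebra.of Φ) d) r)
  rw [map_commutatorWord, rTensorHom_generatorSum] at h
  refine h.symm.trans ?_
  simp

theorem Superalgebra.isMinusOneOne_of_mem_variety {B C : Superalgebra.{u, v} Φ}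
    (hB : B.IsMinusOneOne) (hC : C ∈ B.variety) : C.IsMinusOneOne := by
  let X := FreeNonUnitalNonAssocAlgebra.of Φ (X := ℕ)
  have hlift : ∀ (D : Superalgebra.{u, v} Φ) (s : ℕ → D.envelope) (i j k : ℕ),
      FreeNonUnitalNonAssocAlgebra.lift Φ s (associator (X i) (X j) (X k)) =
        associator (s i) (s j) (s k) := by
    intro D s i j k
    simp [associator, X]
  constructor
  · intro x y
    have h := hC (associator (X 0) (X 1) (X 1)) (fun s => by rw [hlift]; exact hB.1 _ _)
      (fun i => if i = 0 then x else y)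
    rw [hlift] at h
    simpa using h
  · intro x y z
    have h := hC (associator (X 0) (X 1) (X 2) + associator (X 1) (X 2) (X 0) +
      associator (X 2) (X 0) (X 1))
      (fun s => by rw [map_add, map_add, hlift, hlift, hlift]; exact hB.2 _ _ _)
      (fun i => if i = 0 then x else if i = 1 then y else z)
    rw [map_add, map_add, hlift, hlift, hlift] at h
    simpa using h

theorem Superalgebra.mem_variety_self (B : Superalgebra.{u, v} Φ) : B ∈ B.variety :=
  fun _ h => h

end Identities

theorem corollary3p5 (Φ : Type u) [Field Φ] [CharZero Φ] :
    ¬ ∃ B : Superalgebra.{u, u} Φ,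
      FiniteDimensional Φ B.carrier ∧ B.variety = (freeMinusOneOne Φ).variety := by
  rintro ⟨B, hfin, hvar⟩
  have hB : B.IsMinusOneOne := Superalgebra.isMinusOneOne_of_mem_variety
    FreeMinusOneOne.isMinusOneOne (hvar ▸ B.mem_variety_self)
  obtain ⟨r, hr⟩ := exists_commutatorWord_eq_zero B hB
  have hid : ∀ (d : ℕ) (φ : Module.Dual Φ (Grassmann Φ)),
      IsIdentity (wordPolynomial r d φ) (freeMinusOneOne Φ).envelope := by
    intro d φ
    have hF : freeMinusOneOne Φ ∈ B.variety := hvar ▸ (freeMinusOneOne Φ).mem_variety_self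
    refine hF _ fun s => Subtype.ext ?_
    have ht : generatorSum Φ (fun i => (s i).1) d ∈ tensorPart B.envelope 1 :=
      Submodule.sum_mem _ fun i _ => Submodule.subset_span
        ⟨_, (s i).2, _, Grassmann.generator_mem Φ i, rfl⟩
    rw [lift_wordPolynomial, hr _ ht, map_zero]
    rfl
  -- With these values the generic odd element regroups as `z ⊗ x`, `z = ∑ eᵢ ⊗ eᵢ`, so the word
  -- splits off a power of `z`.
  let s : ℕ → (freeMinusOneOne Φ).envelope := fun i =>
    ⟨FreeMinusOneOne.gen Φ ⊗ₜ[Φ] Grassmann.generator Φ i, Submodule.subset_span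
      ⟨1, _, FreeMinusOneOne.gen_mem, _, Grassmann.generator_mem Φ i, rfl⟩⟩
  -- The number of generators equals the degree `4r + 2` of the word: with fewer, `z^(4r+2)` would
  -- already vanish.
  have hzero : commutatorWord (generatorSum Φ (fun i => (s i).1) (4 * r + 2)) r = 0 := by
    refine eq_zero_of_tensorSlice fun φ => ?_
    rw [← lift_wordPolynomial, hid (4 * r + 2) φ s]
    rfl
  have hswap : tensorSwap Φ (freeMinusOneOne Φ).carrier (Grassmann Φ) (Grassmann Φ)
      (generatorSum Φ (fun i => (s i).1) (4 * r + 2)) =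
        diagonalSum Φ (4 * r + 2) ⊗ₜ[Φ] FreeMinusOneOne.gen Φ := by
    rw [generatorSum, map_sum, diagonalSum, TensorProduct.sum_tmul]
    rfl
  have h := congrArg (tensorSwap Φ (freeMinusOneOne Φ).carrier (Grassmann Φ) (Grassmann Φ)) hzero
  rw [map_commutatorWord, hswap, commutatorWord_tmul, map_zero] at h
  exact tmul_ne_zero (diagonalSum_pow_ne_zero Φ _) (commutatorWord_gen_ne_zero Φ r) h
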